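/- **Heavy-tailed operator norm resilience.** There are absolute constants $C_0, C > 0$ such that the following holds. *Setting.* Let $d \ge 1$, let $k \ge 4$ be real, $M = m_k \ge 0$, $b = b_{\mathsf{clip}} > 0$ and $\delta \in (0,1)$. Let $P$ be a probability distribution on $\mathbb{R}^d$ with finite second moments, let $\Sigma = \mathbb{E}_{Z\sim P}[ZZ^T]$ (possibly singular), and write $\|z\|_\Sigma = \|\Sigma^{\dagger/2} z\|_2$, where $\Sigma^{\dagger/2}$ is the square root of the pseudo-inverse of $\Sigma$. Assume that $\big(\mathbb{E}|v^T\Sigma^{\dagger/2}Z|^k\big)^{1/k} \le m_k$ for every unit vector $v$, and that the clipping level is large enough for clipping to be rare, in the sense that $$m_k^2\,\mathbb{P}\big(\|Z\|_\Sigma > b_{\mathsf{clip}}\big)^{1-2/k} \le \tfrac13 .$$ Let $Z_1,\dots,Z_n$ be i.i.d. from $P$, and let $\bar Z_i$ be $Z_i$ clipped at level $b_{\mathsf{clip}}$: $\bar Z_i = \mathrm{clip}(Z_i)$ for a measurable map $\mathrm{clip}$ with $\mathrm{clip}(z) = z$ if $\|z\|_\Sigma \le b_{\mathsf{clip}}$,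 and otherwise $\mathrm{clip}(z) = tz$ for some $t = t(z) \in [0,1]$ with $\|\mathrm{clip}(z)\|_\Sigma \le b_{\mathsf{clip}}$ (for example $\min\{1, b_{\mathsf{clip}}/\|z\|_\Sigma\}\,z$ or $z\,\mathbf{1}\{\|z\|_\Sigma \le b_{\mathsf{clip}}\}$). *Resilience.* For $I \subseteq [n]$ put $\Sigma_I = \frac1n \sum_{i\in I} \bar Z_i\bar Z_i^T$. Let $\mathtt{H}_1$ be the first $\lfloor n/2\rfloor$ indices and $\mathtt{H}_2 = [n]\setminus \mathtt{H}_1$. The sample $\bar{\mathcal{Z}} = (\bar Z_1,\dots,\bar Z_n)$ is $(m,\alpha)$-operator norm resilient if for both $H \in \{\mathtt{H}_1,\mathtt{H}_2\}$ one has $\Sigma_H \preceq \frac34 \Sigma_{[n]}$, and $\Sigma_T \preceq \alpha\,\Sigma_H$ for every $T \subseteq H$ with $|T| \le m$. *Claim.* If $n \ge C_0\, b_{\mathsf{clip}}^2 \log(2d/\delta)$ and $m_{\mathsf{op}} \le n$, then with probability at least $1-4\delta$ the sample $\bar{\mathcal{Z}}$ is $(m_{\mathsf{op}}, \alpha_{\mathsf{op}})$-operator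 norm resilient with $$\alpha_{\mathsf{op}} = C\left(\sqrt{\frac{b_{\mathsf{clip}}^2\log(d/\delta)}{n}} + m_k^2\sqrt{\frac{d+\log(1/\delta)}{n}} + m_k^2\left(\frac{\max\{m_{\mathsf{op}},\, d+\log(1/\delta)\}}{n}\right)^{1-\frac2k}\right).$$ -/

import Mathlib

open MeasureTheory ProbabilityTheory

noncomputable section

namespace HeavyTail

/-- `ℝ^d` with the Euclidean norm. -/
abbrev E (d : ℕ) : Type := EuclideanSpace ℝ (Fin d)

/-- The matrix `𝔼[Z Zᵀ]` for `Z ∼ P`. -/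
def secondMoment {d : ℕ} (P : Measure (E d)) : Matrix (Fin d) (Fin d) ℝ :=
  Matrix.of fun i j => ∫ z, z i * z j ∂P

/-- `S^{†/2}`, the square root of the Moore–Penrose pseudo-inverse of a positive semidefinite
matrix `S`: it has the eigenvectors of `S`, a positive eigenvalue `x` becomes `1 / √x`, and the
eigenvalue `0` stays `0` (in Lean `(√0)⁻¹ = 0`). -/
def pinvSqrt {d : ℕ} (S : Matrix (Fin d) (Fin d) ℝ) : Matrix (Fin d) (Fin d) ℝ :=
  cfc (fun x : ℝ => (√x)⁻¹) S

/-- The whitened vector `S^{†/2} z`. -/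
def whiten {d : ℕ} (S : Matrix (Fin d) (Fin d) ℝ) (z : E d) : E d :=
  WithLp.toLp 2 (Matrix.mulVec (pinvSqrt S) z.ofLp)

/-- `‖z‖_S = ‖S^{†/2} z‖`. -/
def mnorm {d : ℕ} (S : Matrix (Fin d) (Fin d) ℝ) (z : E d) : ℝ := ‖whiten S z‖

/-- `(𝔼 |⟨v, S^{†/2} Z⟩|^k)^{1/k} ≤ M` for every unit vector `v`, where `S = 𝔼[Z Zᵀ]`, `Z ∼ P`. -/
def MomentBound {d : ℕ} (P : Measure (E d)) (k M : ℝ) : Prop :=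
  ∀ v : E d, ‖v‖ = 1 →
    eLpNorm (fun z => inner ℝ v (whiten (secondMoment P) z)) (ENNReal.ofReal k) P
      ≤ ENNReal.ofReal M

/-- `clip` is a clipping map at level `b` for `‖·‖_S`: vectors of norm at most `b` are kept, all
others are shrunk towards the origin to norm at most `b`. Radial projection (`radialClip`) and
replacement by `0` (`zeroClip`) are the two usual choices. -/
def IsClipping {d : ℕ} (S : Matrix (Fin d) (Fin d) ℝ) (b : ℝ) (clip : E d → E d) : Prop :=
  Measurable clip ∧
  (∀ z, mnorm S z ≤ b → clip z = z) ∧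
  (∀ z, b < mnorm S z → ∃ t : ℝ, 0 ≤ t ∧ t ≤ 1 ∧ clip z = t • z ∧ mnorm S (clip z) ≤ b)

/-- `z ↦ min {1, b / ‖z‖_S} z`. -/
def radialClip {d : ℕ} (S : Matrix (Fin d) (Fin d) ℝ) (b : ℝ) (z : E d) : E d :=
  if mnorm S z ≤ b then z else (b / mnorm S z) • z

/-- `z ↦ z 1{‖z‖_S ≤ b}`. -/
def zeroClip {d : ℕ} (S : Matrix (Fin d) (Fin d) ℝ) (b : ℝ) (z : E d) : E d :=
  if mnorm S z ≤ b then z else 0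

lemma mnorm_smul {d : ℕ} (S : Matrix (Fin d) (Fin d) ℝ) (t : ℝ) (z : E d) :
    mnorm S (t • z) = |t| * mnorm S z := by
  simp [mnorm, whiten, Matrix.mulVec_smul, norm_smul]

lemma continuous_mnorm {d : ℕ} (S : Matrix (Fin d) (Fin d) ℝ) : Continuous (mnorm S) := by
  unfold mnorm whiten
  fun_prop

lemma isClipping_radialClip {d : ℕ} (S : Matrix (Fin d) (Fin d) ℝ) {b : ℝ} (hb : 0 ≤ b) :
    IsClipping S b (radialClip S b) := by
  have hm := (continuous_mnorm S).measurable
  refine ⟨?_, fun z hz => by simp [radialClip, hz], fun z hz => ?_⟩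
  · exact Measurable.ite (measurableSet_le hm measurable_const) measurable_id
      ((measurable_const.div hm).smul measurable_id)
  · have h0 : 0 < mnorm S z := lt_of_le_of_lt hb hz
    have he : radialClip S b z = (b / mnorm S z) • z := by simp [radialClip, not_le.2 hz]
    refine ⟨b / mnorm S z, by positivity, (div_le_one h0).2 hz.le, he, ?_⟩
    rw [he, mnorm_smul, abs_of_nonneg (by positivity), div_mul_cancel₀ _ h0.ne']

lemma isClipping_zeroClip {d : ℕ} (S : Matrix (Fin d) (Fin d) ℝ) {b : ℝ} (hb : 0 ≤ b) :
    IsClipping S b (zeroClip S b) := by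
  have hm := (continuous_mnorm S).measurable
  refine ⟨?_, fun z hz => by simp [zeroClip, hz], fun z hz => ?_⟩
  · exact Measurable.ite (measurableSet_le hm measurable_const) measurable_id measurable_const
  · have he : zeroClip S b z = 0 := by simp [zeroClip, not_le.2 hz]
    refine ⟨0, le_rfl, zero_le_one, by simp [he], ?_⟩
    rw [he]
    simpa [mnorm, whiten] using hb

/-- `(1/n) ∑_{i ∈ I} z_i z_iᵀ`; the normalization is by the full sample size `n` for every `I`. -/
def scov {n d : ℕ} (z : Fin n → E d) (I : Finset (Fin n)) : Matrix (Fin d) (Fin d) ℝ :=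
  (1 / (n : ℝ)) • ∑ i ∈ I, Matrix.vecMulVec (z i).ofLp (z i).ofLp

/-- The first half of the indices. -/
def half₁ (n : ℕ) : Finset (Fin n) := Finset.univ.filter fun i => (i : ℕ) < n / 2

/-- The second half of the indices. -/
def half₂ (n : ℕ) : Finset (Fin n) := (half₁ n)ᶜ

/-- `(m, α)`-operator norm resilience: in the Loewner order, for either half `H`, the covariance
of `H` is at most `3/4` of the full one, and any at most `m` indices of `H` contribute at most
`α` times the covariance of `H`. -/
def OpNormResilient {n d : ℕ} (z : Fin n → E d) (m : ℕ) (α : ℝ) : Prop :=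
  ∀ H : Finset (Fin n), H = half₁ n ∨ H = half₂ n →
    ((3 / 4 : ℝ) • scov z Finset.univ - scov z H).PosSemidef ∧
    ∀ T : Finset (Fin n), T ⊆ H → T.card ≤ m → (α • scov z H - scov z T).PosSemidef

/-- The rate
`√(b² log(d/δ)/n) + M² √((d + log(1/δ))/n) + M² (max{m, d + log(1/δ)}/n)^{1 - 2/k}`. -/
def rate (d n m : ℕ) (k M b δ : ℝ) : ℝ :=
  √(b ^ 2 * Real.log (d / δ) / n)
    + M ^ 2 * √((d + Real.log (1 / δ)) / n)
    + M ^ 2 * (max (m : ℝ) (d + Real.log (1 / δ)) / n) ^ (1 - 2 / k)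

end HeavyTail

end

/-!
Whiten the clipped sample and put `Q v = 𝔼⟨v, Y⟩²` for a whitened clipped vector `Y`. On the range
of `Σ^{1/2}`, Hölder's inequality bounds what clipping removes, so that
`2/3 ‖v‖² ≤ Q v ≤ ‖v‖²`. For a unit vector `v` in this range, `‖Y‖ ≤ b` and a matrix Chernoff bound
on each half show that each half carries about half of `n Q v`, which gives the constant `3/4`.
Klein's inequality and the trapezoidal inequality for trace exponentials replace Lieb's concavity
theorem there.

For the contribution of a small set `T`, write it as the sum over the whole sample minus the sum
over the complement of `T`. The latter is at least `∑ min(⟨v, Y⟩², τ) - |T| τ`, and the truncated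
sum is bounded below, uniformly in `v`, by a PAC-Bayes argument that smooths `v` over a ball.
The truncation bias is at most of order `M^k τ^{1 - k/2}`, and balancing it against `|T| τ` gives
the exponent `1 - 2/k`.
-/

namespace HeavyTail

section TraceInequalities

open Matrix NormedSpace

variable {ι : Type*} [Fintype ι] [DecidableEq ι] {X Y : Matrix ι ι ℝ}

lemma cfc_eq_mul_diagonal_mul_transpose (hX : X.IsHermitian) (f : ℝ → ℝ) :
    cfc f X = (hX.eigenvectorUnitary : Matrix ι ι ℝ) * diagonal (f ∘ hX.eigenvalues) *
      (hX.eigenvectorUnitary : Matrix ι ι ℝ)ᵀ := by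
  rw [hX.cfc_eq, IsHermitian.cfc, Unitary.conjStarAlgAut_apply]
  rfl

lemma exp_eq_cfc (hX : X.IsHermitian) : exp X = cfc Real.exp X :=
  open scoped Matrix.Norms.L2Operator in
  (CFC.real_exp_eq_normedSpace_exp hX.isSelfAdjoint).symm

lemma trace_cfc (hX : X.IsHermitian) (f : ℝ → ℝ) :
    trace (cfc f X) = ∑ i, f (hX.eigenvalues i) := by
  have hU : (hX.eigenvectorUnitary : Matrix ι ι ℝ)ᵀ * hX.eigenvectorUnitary = 1 :=
    Unitary.coe_star_mul_self hX.eigenvectorUnitary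
  rw [cfc_eq_mul_diagonal_mul_transpose hX, trace_mul_comm, ← Matrix.mul_assoc, hU, one_mul,
    trace_diagonal]
  rfl

lemma dotProduct_cfc_mulVec (hX : X.IsHermitian) (f : ℝ → ℝ) (v : ι → ℝ) :
    v ⬝ᵥ (cfc f X *ᵥ v) =
      ∑ i, f (hX.eigenvalues i) * ((hX.eigenvectorUnitary : Matrix ι ι ℝ)ᵀ *ᵥ v) i ^ 2 := by
  rw [cfc_eq_mul_diagonal_mul_transpose hX, ← mulVec_mulVec, ← mulVec_mulVec, dotProduct_mulVec,
    ← mulVec_transpose]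
  simp only [dotProduct, mulVec_diagonal, Function.comp_apply]
  exact Finset.sum_congr rfl fun i _ => by ring

/-- The squared inner product of the `i`-th eigenvector of `X` and the `j`-th eigenvector of `Y`.
These are the nonnegative weights with which a trace of products of functions of `X` and of `Y` is
a sum over pairs of eigenvalues, so that scalar inequalities become trace inequalities. -/
noncomputable def eigenOverlap (hX : X.IsHermitian) (hY : Y.IsHermitian) (i j : ι) : ℝ :=
  ((hX.eigenvectorUnitary : Matrix ι ι ℝ)ᵀ * (hY.eigenvectorUnitary : Matrix ι ι ℝ)) i j ^ 2

lemma eigenOverlap_nonneg (hX : X.IsHermitian) (hY : Y.IsHermitian) (i j : ι) :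
    0 ≤ eigenOverlap hX hY i j :=
  sq_nonneg _

lemma eigenOverlap_comm (hX : X.IsHermitian) (hY : Y.IsHermitian) (i j : ι) :
    eigenOverlap hX hY i j = eigenOverlap hY hX j i := by
  rw [eigenOverlap, eigenOverlap, ← transpose_apply (_ * _) j i, transpose_mul,
    transpose_transpose]

lemma trace_cfc_mul_cfc (hX : X.IsHermitian) (hY : Y.IsHermitian) (f g : ℝ → ℝ) :
    trace (cfc f X * cfc g Y) =
      ∑ i, ∑ j, f (hX.eigenvalues i) * g (hY.eigenvalues j) * eigenOverlap hX hY i j := by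
  simp only [eigenOverlap]
  rw [cfc_eq_mul_diagonal_mul_transpose hX, cfc_eq_mul_diagonal_mul_transpose hY]
  set U := (hX.eigenvectorUnitary : Matrix ι ι ℝ)
  set V := (hY.eigenvectorUnitary : Matrix ι ι ℝ)
  set a := f ∘ hX.eigenvalues
  set b := g ∘ hY.eigenvalues
  have hcycle : trace (U * diagonal a * Uᵀ * (V * diagonal b * Vᵀ)) =
      trace (diagonal a * (Uᵀ * V) * (diagonal b * (Uᵀ * V)ᵀ)) := by
    rw [transpose_mul, transpose_transpose]
    simp only [Matrix.mul_assoc]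
    rw [Matrix.trace_mul_comm]
    simp only [Matrix.mul_assoc]
  rw [hcycle, trace]
  refine Finset.sum_congr rfl fun i _ => ?_
  rw [diag_apply, mul_apply]
  refine Finset.sum_congr rfl fun j _ => ?_
  rw [diagonal_mul, diagonal_mul, transpose_apply]
  simp only [a, b, Function.comp_apply]
  ring

lemma trace_cfc_eq_sum_left (hX : X.IsHermitian) (hY : Y.IsHermitian) (f : ℝ → ℝ) :
    trace (cfc f X) = ∑ i, ∑ j, f (hX.eigenvalues i) * eigenOverlap hX hY i j := by
  simpa [cfc_one ℝ Y hY.isSelfAdjoint] using trace_cfc_mul_cfc hX hY f 1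

lemma trace_cfc_eq_sum_right (hX : X.IsHermitian) (hY : Y.IsHermitian) (g : ℝ → ℝ) :
    trace (cfc g Y) = ∑ i, ∑ j, g (hY.eigenvalues j) * eigenOverlap hX hY i j := by
  simpa [cfc_one ℝ X hX.isSelfAdjoint] using trace_cfc_mul_cfc hX hY 1 g

lemma self_mul_cfc (hX : X.IsHermitian) (f : ℝ → ℝ) : X * cfc f X = cfc (fun x => x * f x) X := by
  rw [cfc_mul (fun x => x) f X (by fun_prop) (X.finite_real_spectrum.continuousOn f),
    cfc_id' ℝ X hX.isSelfAdjoint]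

lemma trace_mul_cfc (hX : X.IsHermitian) (hY : Y.IsHermitian) (f : ℝ → ℝ) :
    trace (Y * cfc f X) = ∑ i, ∑ j,
      f (hX.eigenvalues i) * hY.eigenvalues j * eigenOverlap hX hY i j := by
  rw [trace_mul_comm]
  simpa only [cfc_id ℝ Y hY.isSelfAdjoint, id_eq] using trace_cfc_mul_cfc hX hY f id

lemma trace_sub_mul_cfc (hX : X.IsHermitian) (hY : Y.IsHermitian) (f : ℝ → ℝ) :
    trace ((X - Y) * cfc f X) = ∑ i, ∑ j,
      (hX.eigenvalues i - hY.eigenvalues j) * f (hX.eigenvalues i) * eigenOverlap hX hY i j := by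
  rw [Matrix.sub_mul, trace_sub, self_mul_cfc hX, trace_cfc_eq_sum_left hX hY,
    trace_mul_cfc hX hY]
  simp only [← Finset.sum_sub_distrib]
  exact Finset.sum_congr rfl fun i _ => Finset.sum_congr rfl fun j _ => by ring

lemma trace_sub_mul_sub_mul_cfc (hX : X.IsHermitian) (hY : Y.IsHermitian) (f : ℝ → ℝ) :
    trace ((X - Y) * (X - Y) * cfc f X) = ∑ i, ∑ j,
      (hX.eigenvalues i - hY.eigenvalues j) ^ 2 * f (hX.eigenvalues i) *
        eigenOverlap hX hY i j := by
  have hYY : trace (Y * Y * cfc f X) = ∑ i, ∑ j,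
      f (hX.eigenvalues i) * hY.eigenvalues j ^ 2 * eigenOverlap hX hY i j := by
    rw [trace_mul_comm, ← sq, ← cfc_pow_id (R := ℝ) Y 2 hY.isSelfAdjoint, trace_cfc_mul_cfc hX hY]
  have hXY : trace (X * Y * cfc f X) = trace (Y * (cfc f X * X)) := by
    rw [Matrix.mul_assoc, trace_mul_comm, Matrix.mul_assoc]
  have hcomm : cfc f X * X = X * cfc f X := by
    simpa only [cfc_id ℝ X hX.isSelfAdjoint] using (cfc_commute_cfc f id X).eq
  have hexpand : (X - Y) * (X - Y) * cfc f X =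
      X * (X * cfc f X) - X * Y * cfc f X - Y * (X * cfc f X) + Y * Y * cfc f X := by
    noncomm_ring
  rw [hexpand, trace_add, trace_sub, trace_sub, hXY, hcomm, hYY]
  simp only [self_mul_cfc hX, trace_mul_cfc hX hY, trace_cfc_eq_sum_left hX hY]
  simp only [← Finset.sum_sub_distrib, ← Finset.sum_add_distrib]
  exact Finset.sum_congr rfl fun i _ => Finset.sum_congr rfl fun j _ => by ring

/-- Klein's inequality for the exponential. -/
lemma trace_exp_le_trace_exp_add (hX : X.IsHermitian) (hY : Y.IsHermitian) :
    trace (exp X) ≤ trace (exp Y) + trace ((X - Y) * exp X) := by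
  rw [exp_eq_cfc hX, exp_eq_cfc hY, trace_sub_mul_cfc hX hY, trace_cfc_eq_sum_left hX hY,
    trace_cfc_eq_sum_right hX hY]
  simp only [← Finset.sum_add_distrib, ← add_mul]
  refine Finset.sum_le_sum fun i _ => Finset.sum_le_sum fun j _ =>
    mul_le_mul_of_nonneg_right ?_ (eigenOverlap_nonneg hX hY _ _)
  have htangent := mul_le_mul_of_nonneg_right
    (Real.add_one_le_exp (hY.eigenvalues j - hX.eigenvalues i))
    (Real.exp_pos (hX.eigenvalues i)).le
  rw [← Real.exp_add, sub_add_cancel] at htangent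
  linarith

lemma sinh_le_mul_cosh {x : ℝ} (hx : 0 ≤ x) : Real.sinh x ≤ x * Real.cosh x := by
  have hmono : MonotoneOn (fun x => x * Real.cosh x - Real.sinh x) (Set.Ici 0) := by
    refine monotoneOn_of_hasDerivWithinAt_nonneg (f' := fun x => x * Real.sinh x)
      (convex_Ici 0) (by fun_prop) (fun t _ => ?_) fun t ht => ?_
    · have h := ((hasDerivAt_id t).mul (Real.hasDerivAt_cosh t)).sub (Real.hasDerivAt_sinh t)
      exact (h.congr_deriv (by simp)).hasDerivWithinAt
    · rw [interior_Ici, Set.mem_Ioi] at ht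
      exact mul_nonneg ht.le (Real.sinh_nonneg_iff.2 ht.le)
  simpa using hmono Set.self_mem_Ici hx hx

lemma sub_mul_exp_sub_exp_le (x y : ℝ) :
    (x - y) * (Real.exp x - Real.exp y) ≤ (x - y) ^ 2 / 2 * (Real.exp x + Real.exp y) := by
  wlog hxy : y ≤ x generalizing x y
  · linarith [this y x (not_le.1 hxy).le, sub_sq_comm x y]
  have hmean := Real.exp_pos ((x + y) / 2)
  have hx : Real.exp x = Real.exp ((x + y) / 2) * Real.exp ((x - y) / 2) := by
    rw [← Real.exp_add]; ring_nf
  have hy : Real.exp y = Real.exp ((x + y) / 2) * Real.exp (-((x - y) / 2)) := by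
    rw [← Real.exp_add]; ring_nf
  have hsinh := sinh_le_mul_cosh (x := (x - y) / 2) (by linarith)
  rw [Real.sinh_eq, Real.cosh_eq] at hsinh
  rw [hx, hy]
  nlinarith [mul_le_mul_of_nonneg_left hsinh (mul_nonneg (sub_nonneg.2 hxy) hmean.le)]

lemma trace_sub_mul_exp_sub_exp_le (hX : X.IsHermitian) (hY : Y.IsHermitian) :
    trace ((X - Y) * (exp X - exp Y)) ≤ trace ((X - Y) * (X - Y) * (exp X + exp Y)) / 2 := by
  have hleft : trace ((X - Y) * (exp X - exp Y)) =
      trace ((X - Y) * exp X) + trace ((Y - X) * exp Y) := by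
    rw [← trace_add]; noncomm_ring
  have hright : trace ((X - Y) * (X - Y) * (exp X + exp Y)) =
      trace ((X - Y) * (X - Y) * exp X) + trace ((Y - X) * (Y - X) * exp Y) := by
    rw [← trace_add]; noncomm_ring
  rw [hleft, hright, exp_eq_cfc hX, exp_eq_cfc hY, trace_sub_mul_cfc hX hY,
    trace_sub_mul_cfc hY hX, trace_sub_mul_sub_mul_cfc hX hY, trace_sub_mul_sub_mul_cfc hY hX,
    Finset.sum_comm (f := fun i j => _ * eigenOverlap hY hX i j),
    Finset.sum_comm (f := fun i j => _ * eigenOverlap hY hX i j)]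
  simp only [eigenOverlap_comm hY hX, ← Finset.sum_add_distrib, Finset.sum_div]
  refine Finset.sum_le_sum fun i _ => Finset.sum_le_sum fun j _ => ?_
  linarith [mul_le_mul_of_nonneg_right
    (sub_mul_exp_sub_exp_le (hX.eigenvalues i) (hY.eigenvalues j)) (eigenOverlap_nonneg hX hY i j)]

lemma dotProduct_exp_mulVec_nonneg (hX : X.IsHermitian) (v : ι → ℝ) :
    0 ≤ v ⬝ᵥ (exp X *ᵥ v) := by
  rw [exp_eq_cfc hX, dotProduct_cfc_mulVec hX]
  positivity

lemma trace_exp_pos [Nonempty ι] (hX : X.IsHermitian) : 0 < trace (exp X) := by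
  rw [exp_eq_cfc hX, trace_cfc hX]
  positivity

lemma dotProduct_mulVec_le_log_trace_exp (hX : X.IsHermitian) (v : ι → ℝ) :
    v ⬝ᵥ (X *ᵥ v) ≤ Real.log (trace (exp X)) * (v ⬝ᵥ v) := by
  have hquad : v ⬝ᵥ (X *ᵥ v) =
      ∑ i, hX.eigenvalues i * ((hX.eigenvectorUnitary : Matrix ι ι ℝ)ᵀ *ᵥ v) i ^ 2 := by
    simpa only [cfc_id ℝ X hX.isSelfAdjoint, id_eq] using dotProduct_cfc_mulVec hX id v
  have hnorm : v ⬝ᵥ v = ∑ i, ((hX.eigenvectorUnitary : Matrix ι ι ℝ)ᵀ *ᵥ v) i ^ 2 := by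
    simpa [cfc_one ℝ X hX.isSelfAdjoint] using dotProduct_cfc_mulVec hX 1 v
  rw [hquad, hnorm, Finset.mul_sum]
  refine Finset.sum_le_sum fun i _ => mul_le_mul_of_nonneg_right ?_ (sq_nonneg _)
  have hexp : Real.exp (hX.eigenvalues i) ≤ trace (exp X) := by
    rw [exp_eq_cfc hX, trace_cfc hX]
    exact Finset.single_le_sum (fun j _ => (Real.exp_pos (hX.eigenvalues j)).le)
      (Finset.mem_univ i)
  exact (Real.le_log_iff_exp_le ((Real.exp_pos _).trans_le hexp)).2 hexp

lemma trace_vecMulVec_mul {R κ : Type*} [CommSemiring R] [Fintype κ] (v w : κ → R)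
    (A : Matrix κ κ R) : trace (vecMulVec v w * A) = w ⬝ᵥ (A *ᵥ v) := by
  rw [vecMulVec_mul, trace_vecMulVec, dotProduct_mulVec, dotProduct_comm]

/-- The price, relative to its linearization, of adding a rank-one matrix `t v vᵀ` with `‖v‖² ≤ r`
to the exponent of a trace exponential. -/
noncomputable def rankOneFactor (t r : ℝ) : ℝ := (1 + t * r / 2) / (1 - t * r / 2)

/-- Klein's inequality reduces the claim to a comparison of `vᵀ exp (W + t v vᵀ) v` with
`vᵀ exp W v`, which is the trapezoidal inequality since `(v vᵀ)² = ‖v‖² v vᵀ`. -/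
lemma trace_exp_add_smul_vecMulVec_le {W : Matrix ι ι ℝ} (hW : W.IsHermitian) {v : ι → ℝ} {t r : ℝ}
    (hv : v ⬝ᵥ v ≤ r) (htr : |t| * r < 2) :
    trace (exp (W + t • vecMulVec v v)) ≤
      trace (exp W) + rankOneFactor t r * (t * (v ⬝ᵥ (exp W *ᵥ v))) := by
  set X := W + t • vecMulVec v v with hXdef
  have hX : X.IsHermitian := hW.add (.ext fun i j => by simp [vecMulVec_apply, mul_comm])
  have hXW : X - W = t • vecMulVec v v := by simp [hXdef]
  have hvv : vecMulVec v v * vecMulVec v v = (v ⬝ᵥ v) • vecMulVec v v := by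
    rw [vecMulVec_mul_vecMulVec, vecMulVec_smul]
  have hklein := trace_exp_le_trace_exp_add hX hW
  have htrap := trace_sub_mul_exp_sub_exp_le hX hW
  simp only [hXW, Matrix.smul_mul, Matrix.mul_smul, hvv, trace_smul, Matrix.mul_sub,
    Matrix.mul_add, trace_sub, trace_add, trace_vecMulVec_mul, smul_eq_mul] at hklein htrap
  have hpX := dotProduct_exp_mulVec_nonneg hX v
  have hpW := dotProduct_exp_mulVec_nonneg hW v
  set pX := v ⬝ᵥ (exp X *ᵥ v)
  set pW := v ⬝ᵥ (exp W *ᵥ v)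
  have hr : 0 ≤ r := (Finset.sum_nonneg fun i _ => mul_self_nonneg (v i)).trans hv
  have htr' : t * r < 2 := (mul_le_mul_of_nonneg_right (le_abs_self t) hr).trans_lt htr
  have hbound : (v ⬝ᵥ v) * (pX + pW) ≤ r * (pX + pW) := by gcongr
  have hcompare : t * pX ≤ rankOneFactor t r * (t * pW) := by
    rw [rankOneFactor, div_mul_eq_mul_div, le_div_iff₀ (by linarith)]
    nlinarith [mul_le_mul_of_nonneg_left hbound (sq_nonneg t)]
  linarith

end TraceInequalities

section SecondMoment

open Matrix

variable {d : ℕ}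

lemma isHermitian_secondMoment (ν : Measure (E d)) : (secondMoment ν).IsHermitian :=
  .ext fun i j => by simp [secondMoment, mul_comm]

lemma inner_eq_dotProduct (u v : E d) : inner ℝ u v = u.ofLp ⬝ᵥ v.ofLp := by
  simp [PiLp.inner_apply, dotProduct, mul_comm]

lemma dotProduct_self_eq_norm_sq (v : E d) : v.ofLp ⬝ᵥ v.ofLp = ‖v‖ ^ 2 := by
  rw [← inner_eq_dotProduct, real_inner_self_eq_norm_sq]

lemma dotProduct_vecMulVec_self_mulVec (v y : E d) :
    v.ofLp ⬝ᵥ (vecMulVec y.ofLp y.ofLp *ᵥ v.ofLp) = inner ℝ v y ^ 2 := by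
  rw [vecMulVec_mulVec, dotProduct_smul, op_smul_eq_smul, smul_eq_mul, dotProduct_comm y.ofLp,
    inner_eq_dotProduct, sq]

lemma integrable_coord_mul_coord {Ω : Type*} [MeasurableSpace Ω] {μ : Measure Ω} {y : Ω → E d}
    (hy : MemLp y 2 μ) (i j : Fin d) : Integrable (fun ω => y ω i * y ω j) μ :=
  have hcoord (i : Fin d) : MemLp (fun ω => y ω i) 2 μ :=
    (EuclideanSpace.proj i : E d →L[ℝ] ℝ).comp_memLp' hy
  (hcoord i).integrable_mul (hcoord j)

lemma dotProduct_secondMoment_mulVec {ν : Measure (E d)} (hν : MemLp (fun z : E d => z) 2 ν)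
    (v : E d) :
    v.ofLp ⬝ᵥ (secondMoment ν *ᵥ v.ofLp) = ∫ y, inner ℝ v y ^ 2 ∂ν := by
  have hint := integrable_coord_mul_coord hν
  have hexpand (y : E d) : inner ℝ v y ^ 2 = ∑ i, ∑ j, v i * v j * (y i * y j) := by
    rw [inner_eq_dotProduct, dotProduct, sq, Finset.sum_mul_sum]
    exact Finset.sum_congr rfl fun i _ => Finset.sum_congr rfl fun j _ => by ring
  simp only [hexpand]
  rw [integral_finsetSum _ fun i _ => integrable_finsetSum _ fun j _ => (hint i j).const_mul _]
  simp only [integral_finsetSum _ fun j _ => (hint _ j).const_mul _, integral_const_mul,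
    dotProduct, mulVec, Finset.mul_sum, secondMoment, of_apply]
  exact Finset.sum_congr rfl fun i _ => Finset.sum_congr rfl fun j _ => by ring

lemma secondMoment_map_apply {Ω : Type*} [MeasurableSpace Ω] {μ : Measure Ω} {y : Ω → E d}
    (hy : AEMeasurable y μ) (i j : Fin d) :
    secondMoment (μ.map y) i j = ∫ ω, y ω i * y ω j ∂μ := by
  rw [secondMoment, of_apply, integral_map hy]
  exact Continuous.aestronglyMeasurable (by fun_prop)

lemma dotProduct_secondMoment_map_mulVec {Ω : Type*} [MeasurableSpace Ω] {μ : Measure Ω}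
    {y : Ω → E d} (hy : MemLp y 2 μ) (v : E d) :
    v.ofLp ⬝ᵥ (secondMoment (μ.map y) *ᵥ v.ofLp) = ∫ ω, inner ℝ v (y ω) ^ 2 ∂μ := by
  have hym := hy.aestronglyMeasurable.aemeasurable
  rw [dotProduct_secondMoment_mulVec ((memLp_map_measure_iff (by fun_prop) hym).2 hy),
    integral_map hym (by fun_prop)]

end SecondMoment

section MatrixChernoff

open Matrix NormedSpace

variable {Ω : Type*} [MeasurableSpace Ω] {μ : Measure Ω} {d : ℕ}

lemma integrable_comp_of_ae_mem_isCompact [IsFiniteMeasure μ] {F : Type*} [TopologicalSpace F]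
    [MeasurableSpace F] [OpensMeasurableSpace F] {X : Ω → F} (hX : Measurable X) {K : Set F}
    (hK : IsCompact K) (hXK : ∀ᵐ ω ∂μ, X ω ∈ K) {f : F → ℝ} (hf : Continuous f) :
    Integrable (fun ω => f (X ω)) μ := by
  obtain ⟨C, hC⟩ := hK.exists_bound_of_continuousOn hf.continuousOn
  exact .of_bound (hf.measurable.comp hX).aestronglyMeasurable C (hXK.mono fun ω hω => hC _ hω)

lemma continuous_matrix_exp {ι : Type*} [Fintype ι] [DecidableEq ι] :
    Continuous (exp : Matrix ι ι ℝ → Matrix ι ι ℝ) :=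
  open scoped Matrix.Norms.Operator in exp_continuous

lemma integral_dotProduct_mulVec_of_indepFun {y : Ω → E d} (hy : MemLp y 2 μ)
    {A : Ω → Matrix (Fin d) (Fin d) ℝ} (hA : ∀ i j, Integrable (fun ω => A ω i j) μ)
    (hind : ∀ i j, IndepFun (fun ω => A ω i j) y μ) :
    ∫ ω, (y ω).ofLp ⬝ᵥ (A ω *ᵥ (y ω).ofLp) ∂μ =
      ∫ ω, trace (secondMoment (μ.map y) * A ω) ∂μ := by
  have hyy := integrable_coord_mul_coord hy
  have hindij (i j : Fin d) : IndepFun (fun ω => y ω j * y ω i) (fun ω => A ω i j) μ :=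
    ((hind i j).comp measurable_id (ψ := fun z : E d => z j * z i)
      (by fun_prop)).symm
  have hleft (ω : Ω) : (y ω).ofLp ⬝ᵥ (A ω *ᵥ (y ω).ofLp) =
      ∑ j, ∑ i, y ω j * y ω i * A ω i j := by
    rw [← trace_vecMulVec_mul]
    simp [trace, mul_apply, vecMulVec_apply]
  have hright (ω : Ω) : trace (secondMoment (μ.map y) * A ω) =
      ∑ j, ∑ i, secondMoment (μ.map y) j i * A ω i j := by
    simp [trace, mul_apply]
  have hint (i j : Fin d) : Integrable (fun ω => y ω j * y ω i * A ω i j) μ :=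
    (hindij i j).integrable_mul (hyy j i) (hA i j)
  have hint_mean (i j : Fin d) :
      Integrable (fun ω => secondMoment (μ.map y) j i * A ω i j) μ := (hA i j).const_mul _
  simp only [hleft, hright]
  rw [integral_finsetSum _ fun j _ => integrable_finsetSum _ fun i _ => hint i j,
    integral_finsetSum _ fun j _ => integrable_finsetSum _ fun i _ => hint_mean i j]
  refine Finset.sum_congr rfl fun j _ => ?_
  rw [integral_finsetSum _ fun i _ => hint i j,
    integral_finsetSum _ fun i _ => hint_mean i j]
  refine Finset.sum_congr rfl fun i _ => ?_
  rw [integral_const_mul, secondMoment_map_apply hy.aestronglyMeasurable.aemeasurable]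
  exact (hindij i j).integral_fun_mul_eq_mul_integral (hyy j i).aestronglyMeasurable
    (hA i j).aestronglyMeasurable

variable {b t : ℝ}

lemma ae_mem_pi_closedBall {κ : Type*} {Y : κ → Ω → E d}
    (hYb : ∀ i, ∀ᵐ ω ∂μ, ‖Y i ω‖ ≤ b) (s : Finset κ) :
    ∀ᵐ ω ∂μ, (fun i : s => Y i ω) ∈
      Set.univ.pi fun _ : s => Metric.closedBall (0 : E d) b := by
  filter_upwards [ae_all_iff.2 fun i : s => hYb i] with ω hω
  simpa using hω

variable [IsProbabilityMeasure μ]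

/-- In mean, an independent rank-one term in the exponent may be replaced by a multiple of its
expectation. -/
lemma integral_trace_exp_add_vecMulVec_le {F : Type*} [TopologicalSpace F] [MeasurableSpace F]
    [BorelSpace F] {X : Ω → F} (hX : Measurable X) {K : Set F}
    (hK : IsCompact K) (hXK : ∀ᵐ ω ∂μ, X ω ∈ K) {W : F → Matrix (Fin d) (Fin d) ℝ}
    (hWc : Continuous W) (hW : ∀ x, (W x).IsHermitian) {y : Ω → E d} (hy : Measurable y)
    (hyb : ∀ᵐ ω ∂μ, ‖y ω‖ ≤ b) (hind : IndepFun X y μ) (ht : |t| * b ^ 2 < 2) :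
    ∫ ω, trace (exp (W (X ω) + t • vecMulVec (y ω).ofLp (y ω).ofLp)) ∂μ ≤
      ∫ ω, trace (exp (W (X ω) +
        (rankOneFactor t (b ^ 2) * t) • secondMoment (μ.map y))) ∂μ := by
  set Q := secondMoment (μ.map y)
  set c := rankOneFactor t (b ^ 2) * t with hc
  have hexpW : Continuous fun x => exp (W x) := continuous_matrix_exp.comp hWc
  have hint {f : F × E d → ℝ} (hf : Continuous f) : Integrable (fun ω => f (X ω, y ω)) μ := by
    refine integrable_comp_of_ae_mem_isCompact (hX.prodMk hy)
      (hK.prod (isCompact_closedBall (0 : E d) b)) ?_ hf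
    filter_upwards [hXK, hyb] with ω hω hyω
    exact ⟨hω, by simpa using hyω⟩
  have hint_left := hint (f := fun p => trace (exp (W p.1 + t • vecMulVec p.2.ofLp p.2.ofLp)))
    (continuous_matrix_exp.comp ((hWc.comp continuous_fst).add
      ((Continuous.matrix_vecMulVec (by fun_prop) (by fun_prop)).const_smul t))).matrix_trace
  have hint_exp := hint (f := fun p => trace (exp (W p.1)))
    (hexpW.comp continuous_fst).matrix_trace
  have hint_quad := hint (f := fun p => p.2.ofLp ⬝ᵥ (exp (W p.1) *ᵥ p.2.ofLp))
    (Continuous.dotProduct (by fun_prop)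
      ((hexpW.comp continuous_fst).matrix_mulVec (by fun_prop)))
  have hint_mean := hint (f := fun p => trace (Q * exp (W p.1)))
    (continuous_const.matrix_mul (hexpW.comp continuous_fst)).matrix_trace
  have hint_right := hint (f := fun p => trace (exp (W p.1 + c • Q)))
    (continuous_matrix_exp.comp ((hWc.comp continuous_fst).add continuous_const)).matrix_trace
  have hmean : ∫ ω, (y ω).ofLp ⬝ᵥ (exp (W (X ω)) *ᵥ (y ω).ofLp) ∂μ =
      ∫ ω, trace (Q * exp (W (X ω))) ∂μ :=
    integral_dotProduct_mulVec_of_indepFun (.of_bound hy.aestronglyMeasurable b hyb)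
      (fun i j => hint (f := fun p => exp (W p.1) i j)
        ((hexpW.comp continuous_fst).matrix_elem i j))
      fun i j => hind.comp (hexpW.matrix_elem i j).measurable measurable_id
  calc ∫ ω, trace (exp (W (X ω) + t • vecMulVec (y ω).ofLp (y ω).ofLp)) ∂μ
      ≤ ∫ ω, (trace (exp (W (X ω))) + c * ((y ω).ofLp ⬝ᵥ (exp (W (X ω)) *ᵥ (y ω).ofLp))) ∂μ := by
        refine integral_mono_ae hint_left (hint_exp.add (hint_quad.const_mul c)) ?_
        filter_upwards [hyb] with ω hω
        rw [hc, mul_assoc]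
        refine trace_exp_add_smul_vecMulVec_le (hW _) ?_ ht
        rw [dotProduct_self_eq_norm_sq]
        gcongr
    _ = ∫ ω, (trace (exp (W (X ω))) + c * trace (Q * exp (W (X ω)))) ∂μ := by
        rw [integral_add hint_exp (hint_quad.const_mul c),
          integral_add hint_exp (hint_mean.const_mul c), integral_const_mul, integral_const_mul,
          hmean]
    _ ≤ ∫ ω, trace (exp (W (X ω) + c • Q)) ∂μ := by
        refine integral_mono (hint_exp.add (hint_mean.const_mul c)) hint_right fun ω => ?_
        have hklein := trace_exp_le_trace_exp_add (hW (X ω)) ((hW (X ω)).add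
          ((isHermitian_secondMoment (μ.map y)).smul (IsSelfAdjoint.all c)))
        rw [sub_add_cancel_left, neg_mul, trace_neg, smul_mul_assoc, trace_smul,
          smul_eq_mul] at hklein
        linarith

section ChernoffExponent

variable {κ : Type*} [Fintype κ]

/-- The matrix `∑ i, (t y_i y_iᵀ - c Q_i)`, whose exponential has a trace of controlled mean when
`Q_i` is the second moment of the random vector `y_i`. -/
def chernoffExponent (Q : κ → Matrix (Fin d) (Fin d) ℝ) (t c : ℝ) (y : κ → E d) :
    Matrix (Fin d) (Fin d) ℝ :=
  ∑ i, (t • vecMulVec (y i).ofLp (y i).ofLp - c • Q i)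

variable {Q : κ → Matrix (Fin d) (Fin d) ℝ}

lemma continuous_chernoffExponent (c : ℝ) : Continuous (chernoffExponent Q t c) := by
  have hcoord (i : κ) : Continuous fun y : κ → E d => (y i).ofLp := by fun_prop
  exact continuous_finsetSum _ fun i _ =>
    (((hcoord i).matrix_vecMulVec (hcoord i)).const_smul t).sub continuous_const

lemma isHermitian_chernoffExponent (hQ : ∀ i, (Q i).IsHermitian) (c : ℝ) (y : κ → E d) :
    (chernoffExponent Q t c y).IsHermitian :=
  isSelfAdjoint_sum _ fun i _ =>
    IsHermitian.sub (.ext fun _ _ => by simp [vecMulVec_apply, mul_comm])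
      ((hQ i).smul (IsSelfAdjoint.all c))

lemma dotProduct_chernoffExponent_mulVec (c : ℝ) (y : κ → E d) (v : E d) :
    v.ofLp ⬝ᵥ (chernoffExponent Q t c y *ᵥ v.ofLp) =
      t * ∑ i, inner ℝ v (y i) ^ 2 - c * ∑ i, v.ofLp ⬝ᵥ (Q i *ᵥ v.ofLp) := by
  simp only [chernoffExponent, sum_mulVec, sub_mulVec, smul_mulVec, dotProduct_sum,
    dotProduct_sub, dotProduct_smul, dotProduct_vecMulVec_self_mulVec, smul_eq_mul,
    Finset.sum_sub_distrib, Finset.mul_sum]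

end ChernoffExponent

variable {κ : Type*} {Y : κ → Ω → E d}

lemma integral_trace_exp_chernoffExponent_le (hYm : ∀ i, Measurable (Y i))
    (hYb : ∀ i, ∀ᵐ ω ∂μ, ‖Y i ω‖ ≤ b) (hind : iIndepFun Y μ) (ht : |t| * b ^ 2 < 2)
    (s : Finset κ) :
    ∫ ω, trace (exp (chernoffExponent (fun i : s => secondMoment (μ.map (Y i))) t
      (rankOneFactor t (b ^ 2) * t) fun i => Y i ω)) ∂μ ≤ d := by
  classical
  have hcoe (s : Finset κ) (ω : Ω) :
      chernoffExponent (fun i : s => secondMoment (μ.map (Y i))) t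
        (rankOneFactor t (b ^ 2) * t) (fun i => Y i ω) =
      ∑ i ∈ s, (t • vecMulVec (Y i ω).ofLp (Y i ω).ofLp -
        (rankOneFactor t (b ^ 2) * t) • secondMoment (μ.map (Y i))) :=
    Finset.sum_coe_sort s fun i => t • vecMulVec (Y i ω).ofLp (Y i ω).ofLp -
      (rankOneFactor t (b ^ 2) * t) • secondMoment (μ.map (Y i))
  induction s using Finset.induction_on with
  | empty => simp [hcoe]
  | insert j s hj ih =>
    have hindj : IndepFun (fun ω (i : s) => Y i ω) (Y j) μ :=
      (hind.indepFun_finset s {j} (Finset.disjoint_singleton_right.2 hj) hYm).comp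
        measurable_id (measurable_pi_apply (⟨j, Finset.mem_singleton_self j⟩ : ({j} : Finset κ)))
    have hstep := integral_trace_exp_add_vecMulVec_le (measurable_pi_lambda _ fun i : s => hYm i)
      (isCompact_univ_pi fun _ => isCompact_closedBall _ _) (ae_mem_pi_closedBall hYb s)
      (W := fun y => chernoffExponent (fun i : s => secondMoment (μ.map (Y i))) t
        (rankOneFactor t (b ^ 2) * t) y -
        (rankOneFactor t (b ^ 2) * t) • secondMoment (μ.map (Y j)))
      ((continuous_chernoffExponent _).sub continuous_const)
      (fun y => (isHermitian_chernoffExponent (fun i => isHermitian_secondMoment _) _ y).sub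
        ((isHermitian_secondMoment _).smul (IsSelfAdjoint.all _)))
      (hYm j) (hYb j) hindj ht
    simp only [sub_add_cancel] at hstep
    refine le_trans (le_of_eq ?_) (hstep.trans ih)
    simp only [hcoe, Finset.sum_insert hj, sub_add_eq_add_sub, add_sub_assoc, add_comm]

/-- Matrix Chernoff bound, in terms of quadratic forms: `0 < t` is the upper tail and `t < 0` the
lower one. -/
lemma measureReal_exists_sum_inner_sq_gt_le [NeZero d] (hYm : ∀ i, Measurable (Y i))
    (hYb : ∀ i, ∀ᵐ ω ∂μ, ‖Y i ω‖ ≤ b) (hind : iIndepFun Y μ) (ht : |t| * b ^ 2 < 2)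
    (s : Finset κ) {η : ℝ} (hη : 0 < η) :
    μ.real {ω | ∃ v : E d, rankOneFactor t (b ^ 2) * t * ∑ i ∈ s, ∫ ω', inner ℝ v (Y i ω') ^ 2 ∂μ
      + Real.log (d / η) * ‖v‖ ^ 2 < t * ∑ i ∈ s, inner ℝ v (Y i ω) ^ 2} ≤ η := by
  have hexp := integral_trace_exp_chernoffExponent_le hYm hYb hind ht s
  set c := rankOneFactor t (b ^ 2) * t
  set X : Ω → Matrix (Fin d) (Fin d) ℝ := fun ω =>
    chernoffExponent (fun i : s => secondMoment (μ.map (Y i))) t c fun i => Y i ω with hXdef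
  have hX (ω : Ω) : (X ω).IsHermitian :=
    isHermitian_chernoffExponent (fun _ => isHermitian_secondMoment _) c _
  have hint : Integrable (fun ω => trace (exp (X ω))) μ :=
    integrable_comp_of_ae_mem_isCompact (measurable_pi_lambda _ fun i : s => hYm i)
      (isCompact_univ_pi fun _ => isCompact_closedBall _ _) (ae_mem_pi_closedBall hYb s)
      (continuous_matrix_exp.comp (continuous_chernoffExponent c)).matrix_trace
  have hquad (v : E d) (ω : Ω) : v.ofLp ⬝ᵥ (X ω *ᵥ v.ofLp) =
      t * ∑ i ∈ s, inner ℝ v (Y i ω) ^ 2 - c * ∑ i ∈ s, ∫ ω', inner ℝ v (Y i ω') ^ 2 ∂μ := by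
    simp only [hXdef, dotProduct_chernoffExponent_mulVec,
      dotProduct_secondMoment_map_mulVec (.of_bound (hYm _).aestronglyMeasurable b (hYb _))]
    rw [Finset.sum_coe_sort s fun i => inner ℝ v (Y i ω) ^ 2,
      Finset.sum_coe_sort s fun i => ∫ ω', inner ℝ v (Y i ω') ^ 2 ∂μ]
  have hmarkov := mul_meas_ge_le_integral_of_nonneg
    (.of_forall fun ω => (trace_exp_pos (hX ω)).le) hint (d / η)
  have hd : (0 : ℝ) < d := Nat.cast_pos.2 (NeZero.pos d)
  have hmono : {ω | ∃ v : E d, c * ∑ i ∈ s, ∫ ω', inner ℝ v (Y i ω') ^ 2 ∂μ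
      + Real.log (d / η) * ‖v‖ ^ 2 < t * ∑ i ∈ s, inner ℝ v (Y i ω) ^ 2} ⊆
      {ω | d / η ≤ trace (exp (X ω))} := by
    rintro ω ⟨v, hv⟩
    by_contra hlt
    have hlog := Real.log_le_log (trace_exp_pos (hX ω)) (not_le.1 hlt).le
    have hform := dotProduct_mulVec_le_log_trace_exp (hX ω) v.ofLp
    rw [hquad, dotProduct_self_eq_norm_sq] at hform
    nlinarith [sq_nonneg ‖v‖]
  refine (measureReal_mono hmono).trans ?_
  have hle := hmarkov.trans hexp
  rw [div_mul_eq_mul_div, div_le_iff₀ hη] at hle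
  exact le_of_mul_le_mul_left hle hd

end MatrixChernoff

section UniformBall

variable {V : Type*} [NormedAddCommGroup V] [InnerProductSpace ℝ V] [FiniteDimensional ℝ V]
  [MeasurableSpace V] [BorelSpace V]

open Module (finrank)

/-- The uniform distribution on the closed ball of radius `r` around `v`, over which directions
are averaged in the PAC-Bayes argument. -/
noncomputable def ballUnif (v : V) (r : ℝ) : Measure V := volume[|Metric.closedBall v r]

lemma isProbabilityMeasure_ballUnif (v : V) {r : ℝ} (hr : 0 < r) :
    IsProbabilityMeasure (ballUnif v r) :=
  cond_isProbabilityMeasure_of_finite (Metric.measure_closedBall_pos volume v hr).ne'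
    (isCompact_closedBall v r).measure_lt_top.ne

instance isFiniteMeasure_ballUnif (v : V) (r : ℝ) : IsFiniteMeasure (ballUnif v r) := by
  unfold ballUnif; infer_instance

lemma ae_mem_closedBall_ballUnif (v : V) (r : ℝ) :
    ∀ᵐ w ∂ballUnif v r, w ∈ Metric.closedBall v r :=
  ae_cond_mem Metric.isClosed_closedBall.measurableSet

lemma integral_ballUnif (v : V) (r : ℝ) (f : V → ℝ) :
    ∫ w, f w ∂ballUnif v r =
      (volume.real (Metric.closedBall v r))⁻¹ * ∫ w in Metric.closedBall v r, f w := by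
  rw [ballUnif, ProbabilityTheory.cond, integral_smul_measure, ENNReal.toReal_inv, smul_eq_mul,
    Measure.real]

lemma integrable_ballUnif (v : V) (r : ℝ) {f : V → ℝ} (hf : Continuous f) :
    Integrable f (ballUnif v r) :=
  integrable_comp_of_ae_mem_isCompact measurable_id (isCompact_closedBall v r)
    (ae_mem_closedBall_ballUnif v r) hf

lemma integral_ballUnif_eq_integral_add (v : V) (r : ℝ) (f : V → ℝ) :
    ∫ w, f w ∂ballUnif v r = ∫ w, f (v + w) ∂ballUnif 0 r := by
  have htranslate := (measurePreserving_add_left (volume : Measure V) v).setIntegral_preimage_emb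
    (Homeomorph.addLeft v).measurableEmbedding f (Metric.closedBall v r)
  rw [preimage_add_closedBall, sub_self] at htranslate
  rw [integral_ballUnif, integral_ballUnif, htranslate, Measure.addHaar_real_closedBall_center]

lemma integral_ballUnif_isometry (R : V ≃ₗᵢ[ℝ] V) (r : ℝ) (f : V → ℝ) :
    ∫ w, f (R w) ∂ballUnif 0 r = ∫ w, f w ∂ballUnif 0 r := by
  have hrotate := R.measurePreserving.setIntegral_preimage_emb
    R.toHomeomorph.measurableEmbedding f (Metric.closedBall 0 r)
  rw [LinearIsometryEquiv.preimage_closedBall, map_zero] at hrotate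
  rw [integral_ballUnif, integral_ballUnif, ← hrotate]

lemma integral_ballUnif_le_pow_mul {u v : V} {r R : ℝ} (hr : 0 < r) (hvu : dist v u + r ≤ R)
    {f : V → ℝ} (hf : Continuous f) (hf0 : 0 ≤ f) :
    ∫ w, f w ∂ballUnif v r ≤ (R / r) ^ finrank ℝ V * ∫ w, f w ∂ballUnif u R := by
  have hR : 0 < R := by linarith [dist_nonneg (x := v) (y := u)]
  have hmono : ∫ w in Metric.closedBall v r, f w ≤ ∫ w in Metric.closedBall u R, f w :=
    setIntegral_mono_set (hf.continuousOn.integrableOn_compact (isCompact_closedBall u R))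
      (.of_forall hf0)
      (Metric.closedBall_subset_closedBall' (by linarith)).eventuallyLE
  have hunit : 0 < volume.real (Metric.ball (0 : V) 1) :=
    ENNReal.toReal_pos (Metric.measure_ball_pos volume _ one_pos).ne' measure_ball_lt_top.ne
  rw [integral_ballUnif, integral_ballUnif, Measure.addHaar_real_closedBall _ _ hr.le,
    Measure.addHaar_real_closedBall _ _ hR.le]
  calc _ ≤ (r ^ finrank ℝ V * volume.real (Metric.ball (0 : V) 1))⁻¹ *
        ∫ w in Metric.closedBall u R, f w := by gcongr
    _ = _ := by rw [div_pow]; field_simp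

variable (V) in
/-- The variance of the uniform distribution on the unit ball of `V` in any unit direction. -/
noncomputable def ballCoordVariance : ℝ :=
  (∫ w : V, ‖w‖ ^ 2 ∂ballUnif 0 1) / finrank ℝ V

lemma ballCoordVariance_nonneg : 0 ≤ ballCoordVariance V :=
  div_nonneg (integral_nonneg fun _ => sq_nonneg _) (Nat.cast_nonneg _)

lemma ballCoordVariance_mul_finrank_le_one : ballCoordVariance V * finrank ℝ V ≤ 1 := by
  have := isProbabilityMeasure_ballUnif (0 : V) one_pos
  have hle : ∫ w : V, ‖w‖ ^ 2 ∂ballUnif 0 1 ≤ ∫ _w : V, (1 : ℝ) ∂ballUnif 0 1 := by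
    refine integral_mono_ae (integrable_ballUnif 0 1 (by fun_prop)) (integrable_const _) ?_
    filter_upwards [ae_mem_closedBall_ballUnif (0 : V) 1] with w hw
    exact pow_le_one₀ (norm_nonneg w) (mem_closedBall_zero_iff.1 hw)
  rw [integral_const, probReal_univ, one_smul] at hle
  rw [ballCoordVariance, div_mul_comm]
  exact mul_le_one₀ (div_self_le_one _) (integral_nonneg fun _ => sq_nonneg _) hle

lemma integral_ballUnif_inner (y : V) (r : ℝ) : ∫ w, inner ℝ w y ∂ballUnif 0 r = 0 := by
  have hneg := integral_ballUnif_isometry (LinearIsometryEquiv.neg ℝ) r fun w : V => inner ℝ w y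
  simp only [LinearIsometryEquiv.coe_neg, inner_neg_left, integral_neg] at hneg
  linarith

lemma integral_ballUnif_inner_sq_eq_of_norm_eq {x y : V} (h : ‖x‖ = ‖y‖) (r : ℝ) :
    ∫ w, inner ℝ w x ^ 2 ∂ballUnif 0 r = ∫ w, inner ℝ w y ^ 2 ∂ballUnif 0 r := by
  obtain ⟨R, rfl⟩ : ∃ R : V ≃ₗᵢ[ℝ] V, R x = y := ⟨_, Submodule.reflection_sub h⟩
  rw [← integral_ballUnif_isometry R r fun w => inner ℝ w (R x) ^ 2]
  simp only [LinearIsometryEquiv.inner_map_map]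

lemma integral_ballUnif_zero_inner_sq (y : V) :
    ∫ w, inner ℝ w y ^ 2 ∂ballUnif 0 1 = ballCoordVariance V * ‖y‖ ^ 2 := by
  obtain rfl | hy := eq_or_ne y 0
  · simp
  have hdim : (finrank ℝ V : ℝ) ≠ 0 := by
    have : Nontrivial V := ⟨y, 0, hy⟩
    exact Nat.cast_ne_zero.2 Module.finrank_pos.ne'
  let e := stdOrthonormalBasis ℝ V
  have hcoord (i) : ∫ w, inner ℝ w (e i) ^ 2 * ‖y‖ ^ 2 ∂ballUnif 0 1 =
      ∫ w, inner ℝ w y ^ 2 ∂ballUnif 0 1 := by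
    rw [← integral_ballUnif_inner_sq_eq_of_norm_eq (x := ‖y‖ • e i) (by simp [norm_smul])]
    simp only [inner_smul_right, mul_pow, mul_comm]
  have hint (i) : Integrable (fun w => inner ℝ w (e i) ^ 2 * ‖y‖ ^ 2) (ballUnif 0 1) :=
    integrable_ballUnif 0 1 (by fun_prop)
  have hsum : finrank ℝ V * ∫ w, inner ℝ w y ^ 2 ∂ballUnif 0 1 =
      (∫ w : V, ‖w‖ ^ 2 ∂ballUnif 0 1) * ‖y‖ ^ 2 :=
    calc finrank ℝ V * ∫ w, inner ℝ w y ^ 2 ∂ballUnif 0 1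
        = ∑ i, ∫ w, inner ℝ w (e i) ^ 2 * ‖y‖ ^ 2 ∂ballUnif 0 1 := by simp [hcoord]
      _ = ∫ w : V, ‖w‖ ^ 2 * ‖y‖ ^ 2 ∂ballUnif 0 1 := by
        rw [← integral_finsetSum _ fun i _ => hint i]
        simp only [← Finset.sum_mul, e.sum_sq_inner_left]
      _ = _ := integral_mul_const _ _
  rw [ballCoordVariance, div_mul_eq_mul_div, eq_div_iff hdim, mul_comm, hsum]

lemma integral_ballUnif_inner_sq (v y : V) :
    ∫ w, inner ℝ w y ^ 2 ∂ballUnif v 1 = inner ℝ v y ^ 2 + ballCoordVariance V * ‖y‖ ^ 2 := by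
  have := isProbabilityMeasure_ballUnif (0 : V) one_pos
  have hexpand (w : V) : inner ℝ (v + w) y ^ 2 =
      inner ℝ v y ^ 2 + (2 * inner ℝ v y * inner ℝ w y + inner ℝ w y ^ 2) := by
    rw [inner_add_left]; ring
  have hlin : Integrable (fun w : V => 2 * inner ℝ v y * inner ℝ w y) (ballUnif 0 1) :=
    integrable_ballUnif 0 1 (by fun_prop)
  have hsq : Integrable (fun w : V => inner ℝ w y ^ 2) (ballUnif 0 1) :=
    integrable_ballUnif 0 1 (by fun_prop)
  have hlinsq : Integrable (fun w : V => 2 * inner ℝ v y * inner ℝ w y + inner ℝ w y ^ 2)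
    (ballUnif 0 1) := hlin.add hsq
  rw [integral_ballUnif_eq_integral_add]
  simp only [hexpand]
  rw [integral_add (integrable_const _) hlinsq, integral_add hlin hsq, integral_const_mul,
    integral_ballUnif_inner, integral_ballUnif_zero_inner_sq]
  simp

/-- The unbiased estimate of `⟪v, y⟫²` from a direction `w` drawn uniformly from the unit ball
around `v`. -/
noncomputable def debiasedSq (w y : V) : ℝ := inner ℝ w y ^ 2 - ballCoordVariance V * ‖y‖ ^ 2

@[fun_prop]
lemma continuous_debiasedSq : Continuous fun p : V × V => debiasedSq p.1 p.2 := by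
  unfold debiasedSq; fun_prop

lemma integral_ballUnif_debiasedSq (v y : V) :
    ∫ w, debiasedSq w y ∂ballUnif v 1 = inner ℝ v y ^ 2 := by
  have := isProbabilityMeasure_ballUnif v one_pos
  have hsq : Integrable (fun w => inner ℝ w y ^ 2) (ballUnif v 1) :=
    integrable_ballUnif v 1 (by fun_prop)
  simp only [debiasedSq]
  rw [integral_sub hsq (integrable_const _), integral_ballUnif_inner_sq]
  simp

lemma integral_ballUnif_min_debiasedSq_le (v y : V) (τ : ℝ) :
    ∫ w, min (debiasedSq w y) τ ∂ballUnif v 1 ≤ min (inner ℝ v y ^ 2) τ := by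
  have := isProbabilityMeasure_ballUnif v one_pos
  have hcont : Continuous fun w => debiasedSq w y :=
    continuous_debiasedSq.comp (continuous_id.prodMk continuous_const)
  have hmin : Integrable (fun w => min (debiasedSq w y) τ) (ballUnif v 1) :=
    integrable_ballUnif v 1 (hcont.min continuous_const)
  refine le_min ?_ ?_
  · rw [← integral_ballUnif_debiasedSq]
    exact integral_mono hmin (integrable_ballUnif v 1 hcont) fun _ => min_le_left _ _
  · simpa using integral_mono hmin (integrable_const τ) fun _ => min_le_right _ _

end UniformBall

section PacBayes

open Module (finrank)

lemma sub_abs_rpow_mul_le_min {s q k τ : ℝ} (hq : 0 ≤ q) (hk : 2 ≤ k) (hτ : 0 < τ) :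
    s ^ 2 - q - |s| ^ k * τ ^ (1 - k / 2) ≤ min (s ^ 2 - q) τ := by
  have htail : 0 ≤ |s| ^ k * τ ^ (1 - k / 2) := by positivity
  refine le_min (by linarith) ?_
  rcases le_or_gt (s ^ 2) τ with hsτ | hsτ
  · linarith
  · have hs : 0 < |s| := abs_pos.2 (sq_pos_iff.1 (hτ.trans hsτ))
    have hsq : |s| ^ k * (s ^ 2) ^ (1 - k / 2) = s ^ 2 := by
      rw [← sq_abs, ← Real.rpow_natCast, ← Real.rpow_mul hs.le, ← Real.rpow_add hs]
      congr 1; push_cast; ring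
    have hpow : |s| ^ k * (s ^ 2) ^ (1 - k / 2) ≤ |s| ^ k * τ ^ (1 - k / 2) :=
      mul_le_mul_of_nonneg_left (Real.rpow_le_rpow_of_nonpos hτ hsτ.le (by linarith))
        (by positivity)
    linarith

lemma exp_neg_mul_min_le {s q k l τ : ℝ} (hq : 0 ≤ q) (hk : 2 ≤ k) (hl : 0 ≤ l) (hτ : 0 < τ)
    (hlτ : l * τ ≤ 1) (hlq : l * q ≤ 1) :
    Real.exp (-(l * min (s ^ 2 - q) τ)) ≤
      1 - l * (s ^ 2 - q) + l * τ ^ (1 - k / 2) * |s| ^ k + l ^ 2 * (s ^ 4 + q ^ 2) := by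
  have hmin := sub_abs_rpow_mul_le_min (s := s) hq hk hτ
  set u := min (s ^ 2 - q) τ
  have hu_ge : -q ≤ u := le_min (by nlinarith [sq_nonneg s]) (by linarith)
  have hu_le : u ≤ τ := min_le_right _ _
  have hu_le' : u ≤ s ^ 2 - q := min_le_left _ _
  have hlu : |-(l * u)| ≤ 1 := by
    rw [abs_neg, abs_le]
    constructor <;> nlinarith
  have hexp := (abs_le.1 (Real.abs_exp_sub_one_sub_id_le hlu)).2
  have hu_sq : u ^ 2 ≤ s ^ 4 + q ^ 2 := by
    rcases le_or_gt 0 u <;> nlinarith [sq_nonneg s, sq_nonneg (s ^ 2), sq_nonneg q]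
  nlinarith [mul_le_mul_of_nonneg_left hu_sq (sq_nonneg l), mul_le_mul_of_nonneg_left hmin hl]

variable {Ω : Type*} [MeasurableSpace Ω] {μ : Measure Ω}

lemma integral_abs_rpow_le_rpow_of_le [IsProbabilityMeasure μ] {X : Ω → ℝ} {p k C : ℝ}
    (hp : 0 < p) (hpk : p ≤ k) (hC : 0 ≤ C) (hXp : Integrable (fun ω => |X ω| ^ p) μ)
    (hXk : Integrable (fun ω => |X ω| ^ k) μ) (h : ∫ ω, |X ω| ^ k ∂μ ≤ C ^ k) :
    ∫ ω, |X ω| ^ p ∂μ ≤ C ^ p := by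
  have hpow (ω : Ω) : (|X ω| ^ p) ^ (k / p) = |X ω| ^ k := by
    rw [← Real.rpow_mul (abs_nonneg _), mul_div_cancel₀ _ hp.ne']
  have hkp : 0 < k / p := div_pos (hp.trans_le hpk) hp
  have hjensen := (convexOn_rpow ((one_le_div hp).2 hpk)).map_integral_le
    (Real.continuous_rpow_const hkp.le).continuousOn isClosed_Ici
    (.of_forall fun ω => Set.mem_Ici.2 (by positivity)) hXp
    (by simpa only [Function.comp_def, hpow] using hXk)
  simp only [hpow] at hjensen
  refine (Real.rpow_le_rpow_iff (integral_nonneg fun ω => by positivity) (by positivity) hkp).1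
    (hjensen.trans (h.trans_eq ?_))
  rw [← Real.rpow_mul hC, mul_div_cancel₀ _ hp.ne']

lemma integral_le_log_of_integral_exp_le [IsProbabilityMeasure μ] {X : Ω → ℝ} {K : ℝ}
    (hX : Integrable X μ) (hexp : Integrable (fun ω => Real.exp (X ω)) μ)
    (h : ∫ ω, Real.exp (X ω) ∂μ ≤ K) : ∫ ω, X ω ∂μ ≤ Real.log K := by
  have hjensen : Real.exp (∫ ω, X ω ∂μ) ≤ K :=
    (convexOn_exp.map_integral_le Real.continuous_exp.continuousOn isClosed_univ
      (.of_forall fun _ => Set.mem_univ _) hX hexp).trans h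
  exact (Real.le_log_iff_exp_le ((Real.exp_pos _).trans_le hjensen)).2 hjensen

lemma continuous_integral_of_ae_mem_isCompact [IsFiniteMeasure μ] {F G : Type*}
    [TopologicalSpace F] [MeasurableSpace F] [BorelSpace F] [T2Space F]
    [TopologicalSpace G] [FirstCountableTopology G] [LocallyCompactSpace G] {X : Ω → F}
    (hX : Measurable X) {K : Set F} (hK : IsCompact K) (hXK : ∀ᵐ ω ∂μ, X ω ∈ K)
    {f : G → F → ℝ} (hf : Continuous f.uncurry) : Continuous fun x => ∫ ω, f x (X ω) ∂μ := by
  have hmap : (μ.map X).restrict K = μ.map X :=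
    Measure.restrict_eq_self_of_ae_mem ((ae_map_iff hX.aemeasurable hK.measurableSet).2 hXK)
  have hint (x : G) : ∫ ω, f x (X ω) ∂μ = ∫ y in K, f x y ∂μ.map X := by
    rw [hmap, integral_map hX.aemeasurable (hf.uncurry_left x).aestronglyMeasurable]
  simp only [hint]
  exact continuous_parametric_integral_of_continuous hf hK

variable {V : Type*} [NormedAddCommGroup V] [InnerProductSpace ℝ V] [FiniteDimensional ℝ V]

lemma integral_norm_pow_four_le {y : Ω → V} (hy : MemLp y 4 μ) {C : ℝ}
    (hC : ∀ v : V, ‖v‖ = 1 → ∫ ω, inner ℝ v (y ω) ^ 4 ∂μ ≤ C) :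
    ∫ ω, ‖y ω‖ ^ 4 ∂μ ≤ finrank ℝ V ^ 2 * C := by
  let e := stdOrthonormalBasis ℝ V
  have hcoord (i) : Integrable (fun ω => inner ℝ (e i) (y ω) ^ 4) μ := by
    have hcoord4 : MemLp (fun ω => inner ℝ (e i) (y ω)) 4 μ := hy.const_inner (e i)
    exact (hcoord4.integrable_norm_pow (p := 4) (by norm_num)).congr
      (.of_forall fun ω => (by decide : Even 4).pow_abs _)
  have hpoint (ω : Ω) : ‖y ω‖ ^ 4 ≤ finrank ℝ V * ∑ i, inner ℝ (e i) (y ω) ^ 4 := by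
    have := sq_sum_le_card_mul_sum_sq (s := Finset.univ) (f := fun i => inner ℝ (e i) (y ω) ^ 2)
    simpa only [e.sum_sq_inner_right, Finset.card_univ, Fintype.card_fin, ← pow_mul] using this
  calc ∫ ω, ‖y ω‖ ^ 4 ∂μ
      ≤ ∫ ω, finrank ℝ V * ∑ i, inner ℝ (e i) (y ω) ^ 4 ∂μ :=
        integral_mono (hy.integrable_norm_pow (p := 4) (by norm_num))
          ((integrable_finsetSum _ fun i _ => hcoord i).const_mul _) hpoint
    _ = finrank ℝ V * ∑ i, ∫ ω, inner ℝ (e i) (y ω) ^ 4 ∂μ := by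
        rw [integral_const_mul, integral_finsetSum _ fun i _ => hcoord i]
    _ ≤ finrank ℝ V * ∑ _i : Fin (finrank ℝ V), C := by
        gcongr with i
        exact hC _ (e.norm_eq_one i)
    _ = finrank ℝ V ^ 2 * C := by simp; ring

variable [MeasurableSpace V] [BorelSpace V]

lemma integrable_comp_of_ae_norm_le [IsFiniteMeasure μ] {y : Ω → V} {b : ℝ} (hy : Measurable y)
    (hyb : ∀ᵐ ω ∂μ, ‖y ω‖ ≤ b) {f : V → ℝ} (hf : Continuous f) :
    Integrable (fun ω => f (y ω)) μ :=
  integrable_comp_of_ae_mem_isCompact hy (isCompact_closedBall 0 b) (by simpa using hyb) hf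

/-- The bound on the bias and second-order error, per sample point, of the truncated and smoothed
second moment at truncation level `τ` and inverse temperature `l`. -/
noncomputable def truncationBias (k M l τ : ℝ) : ℝ :=
  (2 * M) ^ k * τ ^ (1 - k / 2) + 17 * l * M ^ 4

variable [IsProbabilityMeasure μ] {k M l τ b : ℝ}

lemma integral_inner_pow_four_le {y : Ω → V} (hy : Measurable y) (hyb : ∀ᵐ ω ∂μ, ‖y ω‖ ≤ b)
    (hk : 4 ≤ k) (hM : 0 ≤ M) {w : V}
    (hmom : ∫ ω, |inner ℝ w (y ω)| ^ k ∂μ ≤ (M * ‖w‖) ^ k) :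
    ∫ ω, inner ℝ w (y ω) ^ 4 ∂μ ≤ (M * ‖w‖) ^ 4 := by
  have hint {p : ℝ} (hp : 0 ≤ p) : Integrable (fun ω => |inner ℝ w (y ω)| ^ p) μ :=
    integrable_comp_of_ae_norm_le hy hyb (f := fun x => |inner ℝ w x| ^ p)
      (.rpow_const (by fun_prop) fun _ => .inr hp)
  have hjensen := integral_abs_rpow_le_rpow_of_le (p := 4) (by norm_num) hk
    (mul_nonneg hM (norm_nonneg w)) (hint (by norm_num)) (hint (by linarith)) hmom
  exact_mod_cast (by simpa [(by decide : Even 4).pow_abs] using hjensen :)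

lemma integral_sq_ballCoordVariance_mul_le {y : Ω → V} (hy : Measurable y)
    (hyb : ∀ᵐ ω ∂μ, ‖y ω‖ ≤ b) {C : ℝ} (hC0 : 0 ≤ C)
    (hC : ∀ v : V, ‖v‖ = 1 → ∫ ω, inner ℝ v (y ω) ^ 4 ∂μ ≤ C) :
    ∫ ω, (ballCoordVariance V * ‖y ω‖ ^ 2) ^ 2 ∂μ ≤ C :=
  have hvar : (ballCoordVariance V * finrank ℝ V) ^ 2 ≤ 1 :=
    pow_le_one₀ (mul_nonneg ballCoordVariance_nonneg (Nat.cast_nonneg _))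
      ballCoordVariance_mul_finrank_le_one
  have hy4 : MemLp y 4 μ := .of_bound hy.aestronglyMeasurable b hyb
  calc ∫ ω, (ballCoordVariance V * ‖y ω‖ ^ 2) ^ 2 ∂μ
      = ballCoordVariance V ^ 2 * ∫ ω, ‖y ω‖ ^ 4 ∂μ := by
        rw [← integral_const_mul]
        simp only [mul_pow, ← pow_mul]
    _ ≤ ballCoordVariance V ^ 2 * (finrank ℝ V ^ 2 * C) := by
        gcongr
        exact integral_norm_pow_four_le hy4 hC
    _ = (ballCoordVariance V * finrank ℝ V) ^ 2 * C := by ring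
    _ ≤ C := mul_le_of_le_one_left hC0 hvar

lemma exp_neg_mul_min_debiasedSq_le (w : V) {y : V} (hy : ‖y‖ ≤ b) (hk : 2 ≤ k) (hl : 0 ≤ l)
    (hτ : 0 < τ) (hlτ : l * τ ≤ 1) (hlb : l * b ^ 2 ≤ finrank ℝ V) :
    Real.exp (-(l * min (debiasedSq w y) τ)) ≤
      1 - l * debiasedSq w y + l * τ ^ (1 - k / 2) * |inner ℝ w y| ^ k
        + l ^ 2 * (inner ℝ w y ^ 4 + (ballCoordVariance V * ‖y‖ ^ 2) ^ 2) := by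
  have hvar := ballCoordVariance_nonneg (V := V)
  refine exp_neg_mul_min_le (by positivity) hk hl hτ hlτ ?_
  calc l * (ballCoordVariance V * ‖y‖ ^ 2) ≤ l * (ballCoordVariance V * b ^ 2) := by gcongr
    _ = ballCoordVariance V * (l * b ^ 2) := by ring
    _ ≤ ballCoordVariance V * finrank ℝ V := by gcongr
    _ ≤ 1 := ballCoordVariance_mul_finrank_le_one

lemma integral_exp_neg_mul_min_debiasedSq_le {y : Ω → V} (hy : Measurable y)
    (hyb : ∀ᵐ ω ∂μ, ‖y ω‖ ≤ b) (hk : 4 ≤ k) (hM : 0 ≤ M) (hl : 0 ≤ l) (hτ : 0 < τ)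
    (hlτ : l * τ ≤ 1) (hlb : l * b ^ 2 ≤ finrank ℝ V)
    (hmom : ∀ w : V, ∫ ω, |inner ℝ w (y ω)| ^ k ∂μ ≤ (M * ‖w‖) ^ k) {w : V} (hw : ‖w‖ ≤ 2) :
    ∫ ω, Real.exp (-(l * min (debiasedSq w (y ω)) τ)) ∂μ ≤
      Real.exp (-(l * ∫ ω, debiasedSq w (y ω) ∂μ) + l * truncationBias k M l τ) := by
  have hint {f : V → ℝ} (hf : Continuous f) : Integrable (fun ω => f (y ω)) μ :=
    integrable_comp_of_ae_norm_le hy hyb hf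
  have hdeb : Continuous fun x : V => debiasedSq w x := by unfold debiasedSq; fun_prop
  have hdeb_int := hint hdeb
  have hexp_int := hint (f := fun x => Real.exp (-(l * min (debiasedSq w x) τ))) (by fun_prop)
  have hk_int : Integrable (fun ω => |inner ℝ w (y ω)| ^ k) μ :=
    hint (f := fun x => |inner ℝ w x| ^ k)
      (Continuous.rpow_const (by fun_prop) fun _ => .inr (by linarith))
  have h4_int := hint (f := fun x => inner ℝ w x ^ 4) (by fun_prop)
  have hq_int := hint (f := fun x => (ballCoordVariance V * ‖x‖ ^ 2) ^ 2) (by fun_prop)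
  have hpoint : ∀ᵐ ω ∂μ, Real.exp (-(l * min (debiasedSq w (y ω)) τ)) ≤
      1 - l * debiasedSq w (y ω) + l * τ ^ (1 - k / 2) * |inner ℝ w (y ω)| ^ k
        + l ^ 2 * (inner ℝ w (y ω) ^ 4 + (ballCoordVariance V * ‖y ω‖ ^ 2) ^ 2) :=
    hyb.mono fun ω hω => exp_neg_mul_min_debiasedSq_le w hω (by linarith) hl hτ hlτ hlb
  have hMw : M * ‖w‖ ≤ 2 * M := by nlinarith
  have hmom_k : ∫ ω, |inner ℝ w (y ω)| ^ k ∂μ ≤ (2 * M) ^ k := (hmom w).trans (by gcongr)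
  have hmom_4 : ∫ ω, inner ℝ w (y ω) ^ 4 ∂μ ≤ (2 * M) ^ 4 :=
    (integral_inner_pow_four_le hy hyb hk hM (hmom w)).trans (by gcongr)
  have hvar_4 : ∫ ω, (ballCoordVariance V * ‖y ω‖ ^ 2) ^ 2 ∂μ ≤ M ^ 4 :=
    integral_sq_ballCoordVariance_mul_le hy hyb (by positivity) fun v hv =>
      by simpa [hv] using integral_inner_pow_four_le hy hyb hk hM (hmom v)
  calc ∫ ω, Real.exp (-(l * min (debiasedSq w (y ω)) τ)) ∂μ
      ≤ ∫ ω, (1 - l * debiasedSq w (y ω) + l * τ ^ (1 - k / 2) * |inner ℝ w (y ω)| ^ k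
        + l ^ 2 * (inner ℝ w (y ω) ^ 4 + (ballCoordVariance V * ‖y ω‖ ^ 2) ^ 2)) ∂μ :=
        integral_mono_ae hexp_int (by fun_prop) hpoint
    _ = 1 - l * ∫ ω, debiasedSq w (y ω) ∂μ
        + l * τ ^ (1 - k / 2) * ∫ ω, |inner ℝ w (y ω)| ^ k ∂μ
        + l ^ 2 * (∫ ω, inner ℝ w (y ω) ^ 4 ∂μ
          + ∫ ω, (ballCoordVariance V * ‖y ω‖ ^ 2) ^ 2 ∂μ) := by
        rw [integral_add (by fun_prop) (by fun_prop), integral_add (by fun_prop) (by fun_prop),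
          integral_sub (by fun_prop) (by fun_prop), integral_const_mul, integral_const_mul,
          integral_const_mul, integral_add h4_int hq_int]
        simp
    _ ≤ 1 - l * ∫ ω, debiasedSq w (y ω) ∂μ + l * τ ^ (1 - k / 2) * (2 * M) ^ k
        + l ^ 2 * ((2 * M) ^ 4 + M ^ 4) := by gcongr
    _ = (-(l * ∫ ω, debiasedSq w (y ω) ∂μ) + l * truncationBias k M l τ) + 1 := by
        unfold truncationBias; ring
    _ ≤ _ := Real.add_one_le_exp _

variable {κ : Type*} [Fintype κ] {Y : κ → Ω → V}

/-- The exponent of the PAC-Bayes argument for the sample `y` and the direction `w`: `l` times the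
amount by which the truncated debiased squares fall short of their means, less `R` per sample
point. -/
noncomputable def pacExponent (μ : Measure Ω) (Y : κ → Ω → V) (l τ R : ℝ) (y : κ → V) (w : V) :
    ℝ :=
  l * ∑ i, (∫ ω, debiasedSq w (Y i ω) ∂μ - R - min (debiasedSq w (y i)) τ)

lemma continuous_integral_debiasedSq {y : Ω → V} (hy : Measurable y) (hyb : ∀ᵐ ω ∂μ, ‖y ω‖ ≤ b) :
    Continuous fun w : V => ∫ ω, debiasedSq w (y ω) ∂μ :=
  continuous_integral_of_ae_mem_isCompact hy (isCompact_closedBall 0 b) (by simpa using hyb)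
    continuous_debiasedSq

lemma continuous_pacExponent (hYm : ∀ i, Measurable (Y i)) (hYb : ∀ i, ∀ᵐ ω ∂μ, ‖Y i ω‖ ≤ b)
    (l τ R : ℝ) : Continuous (pacExponent μ Y l τ R).uncurry := by
  unfold pacExponent
  refine continuous_const.mul (continuous_finsetSum _ fun i _ => .sub (.sub ?_ ?_) (.min ?_ ?_))
  · exact (continuous_integral_debiasedSq (hYm i) (hYb i)).comp continuous_snd
  · exact continuous_const
  · exact continuous_debiasedSq.comp
      (continuous_snd.prodMk ((continuous_apply i).comp continuous_fst))
  · exact continuous_const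

lemma integral_exp_pacExponent_le_one (hYm : ∀ i, Measurable (Y i))
    (hYb : ∀ i, ∀ᵐ ω ∂μ, ‖Y i ω‖ ≤ b) (hind : iIndepFun Y μ) (hk : 4 ≤ k) (hM : 0 ≤ M)
    (hl : 0 ≤ l) (hτ : 0 < τ) (hlτ : l * τ ≤ 1) (hlb : l * b ^ 2 ≤ finrank ℝ V)
    (hmom : ∀ i, ∀ w : V, ∫ ω, |inner ℝ w (Y i ω)| ^ k ∂μ ≤ (M * ‖w‖) ^ k)
    {w : V} (hw : ‖w‖ ≤ 2) :
    ∫ ω, Real.exp (pacExponent μ Y l τ (truncationBias k M l τ) (fun i => Y i ω) w) ∂μ ≤ 1 := by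
  set R := truncationBias k M l τ
  set f : κ → V → ℝ := fun i y =>
    Real.exp (l * (∫ ω, debiasedSq w (Y i ω) ∂μ - R)) * Real.exp (-(l * min (debiasedSq w y) τ))
  have hf (i) : Continuous (f i) := by simp only [f, debiasedSq]; fun_prop
  have hprod (ω : Ω) :
      Real.exp (pacExponent μ Y l τ R (fun i => Y i ω) w) = ∏ i, f i (Y i ω) := by
    simp only [pacExponent, f, Finset.mul_sum, Real.exp_sum, ← Real.exp_add]
    exact Finset.prod_congr rfl fun i _ => by ring_nf
  simp only [hprod]
  rw [hind.integral_fun_prod_comp (fun i => (hYm i).aemeasurable)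
    fun i => (hf i).aestronglyMeasurable]
  refine Finset.prod_le_one (fun i _ => integral_nonneg fun ω => by positivity) fun i _ => ?_
  have hone := integral_exp_neg_mul_min_debiasedSq_le (hYm i) (hYb i) hk hM hl hτ hlτ hlb
    (hmom i) hw
  rw [integral_const_mul]
  calc _ ≤ Real.exp (l * (∫ ω, debiasedSq w (Y i ω) ∂μ - R)) *
        Real.exp (-(l * ∫ ω, debiasedSq w (Y i ω) ∂μ) + l * R) := by gcongr
    _ = 1 := by rw [← Real.exp_add, Real.exp_eq_one_iff]; ring

lemma integrable_exp_pacExponent_prod (hYm : ∀ i, Measurable (Y i))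
    (hYb : ∀ i, ∀ᵐ ω ∂μ, ‖Y i ω‖ ≤ b) (l τ R : ℝ) (v : V) (r : ℝ) :
    Integrable (fun p : Ω × V => Real.exp (pacExponent μ Y l τ R (fun i => Y i p.1) p.2))
      (μ.prod (ballUnif v r)) := by
  have hK : IsCompact ((Set.univ.pi fun _ : κ => Metric.closedBall (0 : V) b) ×ˢ
      Metric.closedBall v r) :=
    (isCompact_univ_pi fun _ => isCompact_closedBall 0 b).prod (isCompact_closedBall v r)
  have hball : ∀ᵐ p ∂μ.prod (ballUnif v r), p.2 ∈ Metric.closedBall v r :=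
    (Measure.quasiMeasurePreserving_snd (μ := μ)).ae (ae_mem_closedBall_ballUnif v r)
  have hsample : ∀ᵐ p ∂μ.prod (ballUnif v r), ∀ i, ‖Y i p.1‖ ≤ b :=
    Measure.quasiMeasurePreserving_fst.ae (ae_all_iff.2 hYb)
  refine integrable_comp_of_ae_mem_isCompact (F := (κ → V) × V)
    (X := fun p : Ω × V => (fun i => Y i p.1, p.2)) (by fun_prop) hK ?_
    (Real.continuous_exp.comp (continuous_pacExponent hYm hYb l τ R))
  filter_upwards [hball, hsample] with p hp hYp
  exact ⟨fun i _ => by simpa using hYp i, hp⟩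

lemma measureReal_integral_exp_pacExponent_ge_le (hYm : ∀ i, Measurable (Y i))
    (hYb : ∀ i, ∀ᵐ ω ∂μ, ‖Y i ω‖ ≤ b) (hind : iIndepFun Y μ) (hk : 4 ≤ k) (hM : 0 ≤ M)
    (hl : 0 ≤ l) (hτ : 0 < τ) (hlτ : l * τ ≤ 1) (hlb : l * b ^ 2 ≤ finrank ℝ V)
    (hmom : ∀ i, ∀ w : V, ∫ ω, |inner ℝ w (Y i ω)| ^ k ∂μ ≤ (M * ‖w‖) ^ k)
    {δ : ℝ} (hδ : 0 < δ) :
    μ.real {ω | 1 / δ ≤ ∫ w, Real.exp (pacExponent μ Y l τ (truncationBias k M l τ)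
      (fun i => Y i ω) w) ∂ballUnif 0 2} ≤ δ := by
  have := isProbabilityMeasure_ballUnif (0 : V) two_pos
  set R := truncationBias k M l τ
  have hint := integrable_exp_pacExponent_prod hYm hYb l τ R 0 2
  have hmean : ∫ ω, ∫ w, Real.exp (pacExponent μ Y l τ R (fun i => Y i ω) w) ∂ballUnif 0 2 ∂μ ≤ 1 :=
    calc _ = ∫ w, ∫ ω, Real.exp (pacExponent μ Y l τ R (fun i => Y i ω) w) ∂μ ∂ballUnif 0 2 :=
          integral_integral_swap hint
      _ ≤ ∫ _w : V, (1 : ℝ) ∂ballUnif 0 2 := by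
          refine integral_mono_ae hint.integral_prod_right (integrable_const _) ?_
          filter_upwards [ae_mem_closedBall_ballUnif (0 : V) 2] with w hw
          exact integral_exp_pacExponent_le_one hYm hYb hind hk hM hl hτ hlτ hlb hmom
            (mem_closedBall_zero_iff.1 hw)
      _ = 1 := by simp
  have hmarkov := (mul_meas_ge_le_integral_of_nonneg
    (.of_forall fun ω => integral_nonneg fun w => (Real.exp_pos _).le)
    hint.integral_prod_left (1 / δ)).trans hmean
  rwa [div_mul_eq_mul_div, one_mul, div_le_one hδ] at hmarkov

lemma integral_ballUnif_integral_debiasedSq {y : Ω → V} (hy : Measurable y)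
    (hyb : ∀ᵐ ω ∂μ, ‖y ω‖ ≤ b) (v : V) :
    ∫ w, ∫ ω, debiasedSq w (y ω) ∂μ ∂ballUnif v 1 = ∫ ω, inner ℝ v (y ω) ^ 2 ∂μ := by
  have hball : ∀ᵐ p ∂(ballUnif v 1).prod μ, p.1 ∈ Metric.closedBall v 1 :=
    Measure.quasiMeasurePreserving_fst.ae (ae_mem_closedBall_ballUnif v 1)
  have hsample : ∀ᵐ p ∂(ballUnif v 1).prod μ, ‖y p.2‖ ≤ b :=
    (Measure.quasiMeasurePreserving_snd (μ := ballUnif v 1)).ae hyb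
  have hint : Integrable (Function.uncurry fun (w : V) (ω : Ω) => debiasedSq w (y ω))
      ((ballUnif v 1).prod μ) :=
    integrable_comp_of_ae_mem_isCompact (X := fun p : V × Ω => (p.1, y p.2)) (by fun_prop)
      ((isCompact_closedBall v 1).prod (isCompact_closedBall 0 b))
      (by filter_upwards [hball, hsample] with p hp hyp using ⟨hp, by simpa using hyp⟩)
      continuous_debiasedSq
  rw [integral_integral_swap hint]
  simp only [integral_ballUnif_debiasedSq]

lemma mul_sum_sub_min_le_integral_pacExponent (hYm : ∀ i, Measurable (Y i))
    (hYb : ∀ i, ∀ᵐ ω ∂μ, ‖Y i ω‖ ≤ b) (hl : 0 ≤ l) (τ R : ℝ) (y : κ → V) (v : V) :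
    l * ∑ i, (∫ ω, inner ℝ v (Y i ω) ^ 2 ∂μ - R - min (inner ℝ v (y i) ^ 2) τ) ≤
      ∫ w, pacExponent μ Y l τ R y w ∂ballUnif v 1 := by
  have := isProbabilityMeasure_ballUnif v one_pos
  have hmean (i) : Integrable (fun w => ∫ ω, debiasedSq w (Y i ω) ∂μ) (ballUnif v 1) :=
    integrable_ballUnif v 1 (continuous_integral_debiasedSq (hYm i) (hYb i))
  have hmin (i) : Integrable (fun w => min (debiasedSq w (y i)) τ) (ballUnif v 1) :=
    integrable_ballUnif v 1 (by unfold debiasedSq; fun_prop)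
  have hmeanR (i) : Integrable (fun w => ∫ ω, debiasedSq w (Y i ω) ∂μ - R) (ballUnif v 1) :=
    (hmean i).sub (integrable_const R)
  have hterm (i) : Integrable
      (fun w => ∫ ω, debiasedSq w (Y i ω) ∂μ - R - min (debiasedSq w (y i)) τ) (ballUnif v 1) :=
    (hmeanR i).sub (hmin i)
  unfold pacExponent
  rw [integral_const_mul, integral_finsetSum _ fun i _ => hterm i]
  refine mul_le_mul_of_nonneg_left (Finset.sum_le_sum fun i _ => ?_) hl
  rw [integral_sub (hmeanR i) (hmin i), integral_sub (hmean i) (integrable_const R),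
    integral_ballUnif_integral_debiasedSq (hYm i) (hYb i)]
  simp only [integral_const, probReal_univ, one_smul]
  gcongr
  exact integral_ballUnif_min_debiasedSq_le v (y i) τ

lemma integral_pacExponent_le_log (hYm : ∀ i, Measurable (Y i))
    (hYb : ∀ i, ∀ᵐ ω ∂μ, ‖Y i ω‖ ≤ b) {R δ : ℝ} {y : κ → V}
    (hy : ∫ w, Real.exp (pacExponent μ Y l τ R y w) ∂ballUnif 0 2 ≤ 1 / δ) {v : V}
    (hv : ‖v‖ ≤ 1) :
    ∫ w, pacExponent μ Y l τ R y w ∂ballUnif v 1 ≤ Real.log (2 ^ finrank ℝ V / δ) := by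
  have := isProbabilityMeasure_ballUnif v one_pos
  have hpac : Continuous fun w => pacExponent μ Y l τ R y w :=
    (continuous_pacExponent hYm hYb l τ R).uncurry_left y
  have hexp : Continuous fun w => Real.exp (pacExponent μ Y l τ R y w) :=
    Real.continuous_exp.comp hpac
  have hball := integral_ballUnif_le_pow_mul (u := 0) (R := 2) one_pos
    (by rw [dist_zero_right]; linarith) hexp fun w => (Real.exp_pos _).le
  refine integral_le_log_of_integral_exp_le (integrable_ballUnif v 1 hpac)
    (integrable_ballUnif v 1 hexp) (hball.trans ?_)
  rw [div_one, ← mul_one_div]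
  gcongr

lemma measureReal_exists_sum_min_inner_sq_lt_le (hYm : ∀ i, Measurable (Y i))
    (hYb : ∀ i, ∀ᵐ ω ∂μ, ‖Y i ω‖ ≤ b) (hind : iIndepFun Y μ) (hk : 4 ≤ k) (hM : 0 ≤ M)
    (hl : 0 < l) (hτ : 0 < τ) (hlτ : l * τ ≤ 1) (hlb : l * b ^ 2 ≤ finrank ℝ V)
    (hmom : ∀ i, ∀ w : V, ∫ ω, |inner ℝ w (Y i ω)| ^ k ∂μ ≤ (M * ‖w‖) ^ k)
    {δ : ℝ} (hδ : 0 < δ) :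
    μ.real {ω | ∃ v : V, ‖v‖ ≤ 1 ∧ ∑ i, min (inner ℝ v (Y i ω) ^ 2) τ <
      ∑ i, (∫ ω', inner ℝ v (Y i ω') ^ 2 ∂μ - truncationBias k M l τ)
        - Real.log (2 ^ finrank ℝ V / δ) / l} ≤ δ := by
  refine (measureReal_mono ?_).trans
    (measureReal_integral_exp_pacExponent_ge_le hYm hYb hind hk hM hl.le hτ hlτ hlb hmom hδ)
  rintro ω ⟨v, hv, hlt⟩
  by_contra hω
  have hupper := (mul_sum_sub_min_le_integral_pacExponent hYm hYb hl.le τ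
    (truncationBias k M l τ) (fun i => Y i ω) v).trans
    (integral_pacExponent_le_log hYm hYb (not_le.1 hω).le hv)
  rw [Finset.sum_sub_distrib, mul_comm, ← le_div_iff₀ hl] at hupper
  linarith

end PacBayes

section Parameters

variable {d n m : ℕ} {k M b δ : ℝ}

/-- The relative error `√(b² log(2d/δ)/n)` of the matrix Chernoff bound. -/
noncomputable def chernoffError (d n : ℕ) (b δ : ℝ) : ℝ := √(b ^ 2 * Real.log (2 * d / δ) / n)

/-- The level at which squared projections are truncated. It balances the mass
`(2M)^k τ^(1 - k/2)` lost by truncation against the bound `τ |T| / n` for the truncated squares of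
`|T| ≤ max {m, d + log(1/δ)}` points. -/
noncomputable def truncationLevel (d n m : ℕ) (k M δ : ℝ) : ℝ :=
  4 * M ^ 2 * (max (m : ℝ) (d + Real.log (1 / δ)) / n) ^ (-(2 / k))

/-- The scale `l` of the PAC-Bayes bound, as large as allowed by `l τ ≤ 1` and `l b² ≤ d`, and small
enough for the fourth moment term `l M⁴` not to exceed `M² √((d + log(1/δ))/n)`. -/
noncomputable def pacBayesScale (d n m : ℕ) (k M b δ : ℝ) : ℝ :=
  min (1 / truncationLevel d n m k M δ)
    (min (√((d + Real.log (1 / δ)) / n) / M ^ 2) (d / b ^ 2))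

lemma two_mul_log_two_le_log_one_div (hδ : 0 < δ) (hδ' : δ ≤ 1 / 4) :
    2 * Real.log 2 ≤ Real.log (1 / δ) := by
  rw [← Nat.cast_two, ← Real.log_pow]
  refine Real.log_le_log (by norm_num) ((le_div_iff₀ hδ).2 ?_)
  norm_num
  linarith

lemma log_one_div_le_log_div [NeZero d] (hδ : 0 < δ) : Real.log (1 / δ) ≤ Real.log (d / δ) :=
  Real.log_le_log (by positivity) (by gcongr; exact Nat.one_le_cast.2 NeZero.one_le)

lemma log_two_mul_div [NeZero d] (hδ : 0 < δ) :
    Real.log (2 * d / δ) = Real.log 2 + Real.log (d / δ) := by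
  have hd : (0 : ℝ) < d := Nat.cast_pos.2 (NeZero.pos d)
  rw [mul_div_assoc, Real.log_mul two_ne_zero (by positivity)]

lemma two_le_log_two_mul_div [NeZero d] (hδ : 0 < δ) (hδ' : δ ≤ 1 / 4) :
    2 ≤ Real.log (2 * d / δ) := by
  linarith [two_mul_log_two_le_log_one_div hδ hδ', log_one_div_le_log_div (d := d) hδ,
    log_two_mul_div (d := d) hδ, Real.log_two_gt_d9]

lemma dim_add_log_pos [NeZero d] (hδ : 0 < δ) (hδ' : δ ≤ 1) : 0 < d + Real.log (1 / δ) :=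
  add_pos_of_pos_of_nonneg (Nat.cast_pos.2 (NeZero.pos d))
    (Real.log_nonneg ((one_le_div hδ).2 hδ'))

lemma max_dim_add_log_pos [NeZero d] (m : ℕ) (hδ : 0 < δ) (hδ' : δ ≤ 1) :
    0 < max (m : ℝ) (d + Real.log (1 / δ)) :=
  lt_max_of_lt_right (dim_add_log_pos hδ hδ')

lemma rpow_mul_truncation_rpow {x : ℝ} (hM : 0 < M) (hx : 0 < x) (hk : k ≠ 0) :
    (2 * M) ^ k * (4 * M ^ 2 * x ^ (-(2 / k))) ^ (1 - k / 2) = 4 * M ^ 2 * x ^ (1 - 2 / k) := by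
  have hM4 : (4 * M ^ 2 : ℝ) = (2 * M) ^ (2 : ℝ) := by
    rw [Real.rpow_two]
    ring
  rw [hM4, Real.mul_rpow (x := (2 * M) ^ (2 : ℝ)) (by positivity) (by positivity),
    ← Real.rpow_mul (by positivity), ← Real.rpow_mul hx.le, ← mul_assoc,
    ← Real.rpow_add (by positivity)]
  congr 2
  · ring
  · field_simp
    ring

lemma chernoffError_nonneg : 0 ≤ chernoffError d n b δ := Real.sqrt_nonneg _

lemma sq_chernoffError [NeZero d] (hδ : 0 < δ) (hδ' : δ ≤ 1 / 4) :
    chernoffError d n b δ ^ 2 = b ^ 2 * Real.log (2 * d / δ) / n := by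
  have := two_le_log_two_mul_div (d := d) hδ hδ'
  exact Real.sq_sqrt (by positivity)

lemma chernoffError_le_inv_twenty (hn0 : 0 < n)
    (hn : 400 * (b ^ 2 * Real.log (2 * d / δ)) ≤ n) : chernoffError d n b δ ≤ 1 / 20 := by
  refine Real.sqrt_le_iff.2 ⟨by norm_num, ?_⟩
  rw [div_le_iff₀ (Nat.cast_pos.2 hn0)]
  linarith

lemma chernoffError_le_mul_sqrt [NeZero d] (hδ : 0 < δ) (hδ' : δ ≤ 1 / 4) :
    chernoffError d n b δ ≤ 1.3 * √(b ^ 2 * Real.log (d / δ) / n) := by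
  have hlog : Real.log (2 * d / δ) ≤ 1.3 ^ 2 * Real.log (d / δ) := by
    linarith [two_mul_log_two_le_log_one_div hδ hδ', log_one_div_le_log_div (d := d) hδ,
      log_two_mul_div (d := d) hδ, Real.log_two_gt_d9]
  rw [chernoffError, ← Real.sqrt_sq (by norm_num : (0 : ℝ) ≤ 1.3), ← Real.sqrt_mul (by positivity)]
  refine Real.sqrt_le_sqrt ?_
  calc b ^ 2 * Real.log (2 * d / δ) / n ≤ b ^ 2 * (1.3 ^ 2 * Real.log (d / δ)) / n := by gcongr
    _ = 1.3 ^ 2 * (b ^ 2 * Real.log (d / δ) / n) := by ring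

lemma truncationLevel_pos [NeZero d] (hn0 : 0 < n) (hM : 0 < M) (hδ : 0 < δ) (hδ' : δ ≤ 1) :
    0 < truncationLevel d n m k M δ := by
  have := max_dim_add_log_pos (d := d) m hδ hδ'
  rw [truncationLevel]
  positivity

lemma max_mul_truncationLevel [NeZero d] (hn0 : 0 < n) (hδ : 0 < δ) (hδ' : δ ≤ 1) :
    max (m : ℝ) (d + Real.log (1 / δ)) * truncationLevel d n m k M δ =
      n * (4 * (M ^ 2 * (max (m : ℝ) (d + Real.log (1 / δ)) / n) ^ (1 - 2 / k))) := by
  have hD := max_dim_add_log_pos (d := d) m hδ hδ'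
  have hD' := div_pos hD (Nat.cast_pos.2 hn0)
  rw [truncationLevel, sub_eq_add_neg, Real.rpow_add hD', Real.rpow_one]
  field_simp

lemma pacBayesScale_pos [NeZero d] (hn0 : 0 < n) (hM : 0 < M) (hb : 0 < b) (hδ : 0 < δ)
    (hδ' : δ ≤ 1) : 0 < pacBayesScale d n m k M b δ := by
  have hτ := truncationLevel_pos (d := d) (m := m) (k := k) hn0 hM hδ hδ'
  have hD₀ := dim_add_log_pos (d := d) hδ hδ'
  have hd : (0 : ℝ) < d := Nat.cast_pos.2 (NeZero.pos d)
  exact lt_min (by positivity) (lt_min (by positivity) (by positivity))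

lemma pacBayesScale_mul_truncationLevel_le_one [NeZero d] (hn0 : 0 < n) (hM : 0 < M) (hδ : 0 < δ)
    (hδ' : δ ≤ 1) : pacBayesScale d n m k M b δ * truncationLevel d n m k M δ ≤ 1 :=
  (le_div_iff₀ (truncationLevel_pos hn0 hM hδ hδ')).1 (min_le_left _ _)

lemma pacBayesScale_mul_sq_le (hb : 0 < b) : pacBayesScale d n m k M b δ * b ^ 2 ≤ d :=
  (le_div_iff₀ (by positivity)).1 ((min_le_right _ _).trans (min_le_right _ _))

lemma pacBayesScale_mul_pow_four_le (hM : 0 < M) :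
    pacBayesScale d n m k M b δ * M ^ 4 ≤ M ^ 2 * √((d + Real.log (1 / δ)) / n) := by
  calc pacBayesScale d n m k M b δ * M ^ 4
      ≤ √((d + Real.log (1 / δ)) / n) / M ^ 2 * M ^ 4 := by
        gcongr
        exact (min_le_right _ _).trans (min_le_left _ _)
    _ = M ^ 2 * √((d + Real.log (1 / δ)) / n) := by field_simp

lemma one_div_min_le_add {x y : ℝ} (hx : 0 < x) (hy : 0 < y) :
    1 / min x y ≤ 1 / x + 1 / y := by
  rcases min_choice x y with h | h <;> rw [h]
  · exact le_add_of_nonneg_right (by positivity)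
  · exact le_add_of_nonneg_left (by positivity)

lemma one_div_pacBayesScale_le [NeZero d] (hn0 : 0 < n) (hM : 0 < M) (hb : 0 < b) (hδ : 0 < δ)
    (hδ' : δ ≤ 1) :
    1 / pacBayesScale d n m k M b δ ≤ truncationLevel d n m k M δ +
      (M ^ 2 / √((d + Real.log (1 / δ)) / n) + b ^ 2 / d) := by
  have hτ := truncationLevel_pos (d := d) (m := m) (k := k) hn0 hM hδ hδ'
  have hD₀ := dim_add_log_pos (d := d) hδ hδ'
  have hd : (0 : ℝ) < d := Nat.cast_pos.2 (NeZero.pos d)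
  have hw : 0 < √((d + Real.log (1 / δ)) / n) / M ^ 2 := by positivity
  have hd' : 0 < d / b ^ 2 := by positivity
  refine (one_div_min_le_add (one_div_pos.2 hτ) (lt_min hw hd')).trans ?_
  rw [one_div_one_div, ← one_div_div _ (M ^ 2), ← one_div_div (d : ℝ)]
  gcongr
  exact one_div_min_le_add hw hd'

lemma dim_add_log_mul_sq_div_dim_le [NeZero d] (hn0 : 0 < n) (hδ : 0 < δ) (hδ' : δ ≤ 1 / 4)
    (hn : b ^ 2 * Real.log (2 * d / δ) ≤ n) :
    (d + Real.log (1 / δ)) * (b ^ 2 / d) ≤ n * (2 * √(b ^ 2 * Real.log (d / δ) / n)) := by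
  have hd : (1 : ℝ) ≤ d := Nat.one_le_cast.2 NeZero.one_le
  have hn0' : (0 : ℝ) < n := Nat.cast_pos.2 hn0
  have hlog := two_mul_log_two_le_log_one_div hδ hδ'
  have hlog_le := log_one_div_le_log_div (d := d) hδ
  have hlog_two := log_two_mul_div (d := d) hδ
  have h2 := Real.log_two_gt_d9
  have hdim : (d + Real.log (1 / δ)) / d ≤ 2 * Real.log (d / δ) := by
    rw [add_div, div_self (by positivity)]
    linarith [div_le_self (by linarith : 0 ≤ Real.log (1 / δ)) hd]
  have hA0 : 0 ≤ b ^ 2 * Real.log (d / δ) / n := by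
    have : 0 ≤ Real.log (d / δ) := by linarith
    positivity
  have hA1 : b ^ 2 * Real.log (d / δ) / n ≤ 1 := by
    rw [div_le_one hn0']
    exact (mul_le_mul_of_nonneg_left (by linarith) (sq_nonneg b)).trans hn
  calc (d + Real.log (1 / δ)) * (b ^ 2 / d) = b ^ 2 * ((d + Real.log (1 / δ)) / d) := by ring
    _ ≤ b ^ 2 * (2 * Real.log (d / δ)) := by gcongr
    _ = n * (2 * (b ^ 2 * Real.log (d / δ) / n)) := by field_simp
    _ ≤ n * (2 * √(b ^ 2 * Real.log (d / δ) / n)) := by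
        gcongr
        exact Real.le_sqrt_of_sq_le (by nlinarith)

lemma dim_add_log_div_pacBayesScale_le [NeZero d] (hn0 : 0 < n) (hM : 0 < M) (hb : 0 < b)
    (hδ : 0 < δ) (hδ' : δ ≤ 1 / 4) (hn : b ^ 2 * Real.log (2 * d / δ) ≤ n) :
    (d + Real.log (1 / δ)) / pacBayesScale d n m k M b δ ≤ n * (4 * rate d n m k M b δ) := by
  have hδ1 : δ ≤ 1 := by linarith
  have hD₀ := dim_add_log_pos (d := d) hδ hδ1
  have hτ := truncationLevel_pos (d := d) (m := m) (k := k) hn0 hM hδ hδ1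
  set D₀ := d + Real.log (1 / δ)
  have hG := (mul_le_mul_of_nonneg_right (le_max_right (m : ℝ) D₀) hτ.le).trans_eq
    (max_mul_truncationLevel hn0 hδ hδ1)
  have hB : D₀ * (M ^ 2 / √(D₀ / n)) = n * (M ^ 2 * √(D₀ / n)) := by
    rw [← mul_div_assoc, div_eq_iff (by positivity), mul_assoc, mul_assoc, Real.mul_self_sqrt]
    · field_simp
    · positivity
  have hA := dim_add_log_mul_sq_div_dim_le hn0 hδ hδ' hn
  have hB0 : 0 ≤ n * (M ^ 2 * √(D₀ / n)) := by positivity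
  calc D₀ / pacBayesScale d n m k M b δ = D₀ * (1 / pacBayesScale d n m k M b δ) := by ring
    _ ≤ D₀ * (truncationLevel d n m k M δ + (M ^ 2 / √(D₀ / n) + b ^ 2 / d)) := by
        gcongr
        exact one_div_pacBayesScale_le hn0 hM hb hδ hδ1
    _ ≤ n * (4 * rate d n m k M b δ) := by
        have : 0 ≤ n * √(b ^ 2 * Real.log (d / δ) / n) := by positivity
        simp only [rate, mul_add] at *
        linarith

lemma log_two_pow_div_le (hδ : 0 < δ) : Real.log (2 ^ d / δ) ≤ d + Real.log (1 / δ) := by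
  rw [div_eq_mul_one_div, Real.log_mul (by positivity) (by positivity), Real.log_pow]
  gcongr
  exact mul_le_of_le_one_right (by positivity) (by linarith [Real.log_two_lt_d9])

lemma truncationBias_le_rate [NeZero d] (hn0 : 0 < n) (hM : 0 < M) (hk : k ≠ 0)
    (hδ : 0 < δ) (hδ' : δ ≤ 1) :
    truncationBias k M (pacBayesScale d n m k M b δ) (truncationLevel d n m k M δ) ≤
      17 * rate d n m k M b δ := by
  have hD := max_dim_add_log_pos (d := d) m hδ hδ'
  have hG : 0 ≤ M ^ 2 * (max (m : ℝ) (d + Real.log (1 / δ)) / n) ^ (1 - 2 / k) := by positivity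
  have hA := Real.sqrt_nonneg (b ^ 2 * Real.log (d / δ) / n)
  have hB := pacBayesScale_mul_pow_four_le (d := d) (n := n) (m := m) (k := k) (b := b) (δ := δ) hM
  rw [truncationBias, truncationLevel, rpow_mul_truncation_rpow hM (by positivity) hk, rate]
  linarith

lemma card_mul_truncationLevel_le_rate [NeZero d] (hn0 : 0 < n) (hM : 0 < M) (hδ : 0 < δ)
    (hδ' : δ ≤ 1) {c : ℕ} (hc : c ≤ m) :
    c * truncationLevel d n m k M δ ≤ n * (4 * rate d n m k M b δ) := by
  have hτ := truncationLevel_pos (d := d) (m := m) (k := k) hn0 hM hδ hδ'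
  have hA := Real.sqrt_nonneg (b ^ 2 * Real.log (d / δ) / n)
  have hB : 0 ≤ M ^ 2 * √((d + Real.log (1 / δ)) / n) := by positivity
  calc c * truncationLevel d n m k M δ
      ≤ max (m : ℝ) (d + Real.log (1 / δ)) * truncationLevel d n m k M δ := by
        gcongr
        exact (Nat.cast_le.2 hc).trans (le_max_left _ _)
    _ = _ := max_mul_truncationLevel hn0 hδ hδ'
    _ ≤ n * (4 * rate d n m k M b δ) := by
        gcongr
        exact le_add_of_nonneg_left (add_nonneg hA hB)

lemma chernoffError_le_rate [NeZero d] (hδ : 0 < δ) (hδ' : δ ≤ 1 / 4) :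
    chernoffError d n b δ ≤ 1.3 * rate d n m k M b δ := by
  have hD := max_dim_add_log_pos (d := d) m hδ (hδ'.trans (by norm_num))
  refine (chernoffError_le_mul_sqrt hδ hδ').trans ?_
  gcongr
  rw [rate, add_assoc]
  exact le_add_of_nonneg_right (by positivity)

end Parameters

section ScalarResilience

lemma card_half₁ (n : ℕ) : (half₁ n).card = n / 2 := by
  rw [half₁, Fin.card_filter_val_lt]
  exact min_eq_right (Nat.div_le_self n 2)

lemma card_half₂ (n : ℕ) : (half₂ n).card = n - n / 2 := by
  rw [half₂, Finset.card_compl, card_half₁, Fintype.card_fin]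

lemma card_half_bounds {n : ℕ} (hn : 100 ≤ n) {H : Finset (Fin n)}
    (hH : H = half₁ n ∨ H = half₂ n) : 0.495 * (n : ℝ) ≤ H.card ∧ (H.card : ℝ) ≤ 0.505 * n := by
  have hcard : 495 * n ≤ 1000 * H.card ∧ 1000 * H.card ≤ 505 * n := by
    rcases hH with rfl | rfl
    · rw [card_half₁]
      omega
    · rw [card_half₂]
      omega
  have hlower : (495 : ℝ) * n ≤ 1000 * H.card := mod_cast hcard.1
  have hupper : (1000 : ℝ) * H.card ≤ 505 * n := mod_cast hcard.2
  constructor <;> linarith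

/-- `(m, α)`-operator norm resilience of a sample in one direction, in terms of the squared
projections `x i` of the sample onto that direction. -/
def SumResilient {n : ℕ} (x : Fin n → ℝ) (m : ℕ) (α : ℝ) : Prop :=
  ∀ H : Finset (Fin n), H = half₁ n ∨ H = half₂ n →
    ∑ i ∈ H, x i ≤ 3 / 4 * ∑ i, x i ∧
    ∀ T : Finset (Fin n), T ⊆ H → T.card ≤ m → ∑ i ∈ T, x i ≤ α * ∑ i ∈ H, x i

lemma SumResilient.const_mul {n : ℕ} {x : Fin n → ℝ} {m : ℕ} {α : ℝ} (h : SumResilient x m α)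
    {c : ℝ} (hc : 0 ≤ c) : SumResilient (fun i => c * x i) m α := by
  intro H hH
  obtain ⟨hhalf, hsubset⟩ := h H hH
  simp only [← Finset.mul_sum]
  refine ⟨?_, fun T hTH hT => ?_⟩
  · linarith [mul_le_mul_of_nonneg_left hhalf hc]
  · linarith [mul_le_mul_of_nonneg_left (hsubset T hTH hT) hc]

/-- The sum of `x` over `s` is `#s q` up to an error of order `e` in both directions; the additive
error is relative to the full sample size. -/
def ConcentratesOn {ι : Type*} [Fintype ι] (x : ι → ℝ) (e q : ℝ) (s : Finset ι) : Prop :=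
  s.card * ((1 - e) * q) - Fintype.card ι * e ≤ ∑ i ∈ s, x i ∧
    ∑ i ∈ s, x i ≤ s.card * ((1 + 2 * e) * q) + Fintype.card ι * e

section ConcentratesOn

variable {ι : Type*} [Fintype ι] {x : ι → ℝ} {e q : ℝ} {s : Finset ι}

lemma ConcentratesOn.sum_le_three_quarters_mul [DecidableEq ι] (hs : ConcentratesOn x e q s)
    (hsc : ConcentratesOn x e q sᶜ) (he : 0 ≤ e) (he' : e ≤ 1 / 20) (hq : 2 / 3 ≤ q)
    (hcard : (s.card : ℝ) ≤ 0.505 * Fintype.card ι)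
    (hcard_compl : 0.495 * Fintype.card ι ≤ (sᶜ.card : ℝ)) :
    ∑ i ∈ s, x i ≤ 3 / 4 * ∑ i, x i := by
  have hN : (0 : ℝ) ≤ Fintype.card ι * q := by positivity
  have hupper : s.card * ((1 + 2 * e) * q) ≤ 0.505 * Fintype.card ι * (1.1 * q) := by
    gcongr
    linarith
  have hlower : 0.495 * Fintype.card ι * (0.95 * q) ≤ sᶜ.card * ((1 - e) * q) := by
    gcongr
    linarith
  have herr : Fintype.card ι * e ≤ 0.075 * (Fintype.card ι * q) := by
    calc Fintype.card ι * e ≤ Fintype.card ι * (0.075 * q) := by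
          gcongr
          linarith
      _ = 0.075 * (Fintype.card ι * q) := by ring
  have hsum := Finset.sum_add_sum_compl s x
  linarith [hs.2, hsc.1]

lemma ConcentratesOn.card_div_four_le_sum (hs : ConcentratesOn x e q s) (he : e ≤ 1 / 20)
    (hq : 2 / 3 ≤ q) (hcard : 0.495 * Fintype.card ι ≤ (s.card : ℝ)) :
    (Fintype.card ι : ℝ) / 4 ≤ ∑ i ∈ s, x i := by
  have hlower : 0.495 * Fintype.card ι * (0.95 * (2 / 3)) ≤ s.card * ((1 - e) * q) := by
    have : (0.95 : ℝ) ≤ 1 - e := by linarith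
    gcongr
  have herr : Fintype.card ι * e ≤ Fintype.card ι * (1 / 20) := by gcongr
  linarith [hs.1, (Nat.cast_nonneg (Fintype.card ι) : (0 : ℝ) ≤ _)]

lemma ConcentratesOn.sum_univ_le [DecidableEq ι] (hs : ConcentratesOn x e q s)
    (hsc : ConcentratesOn x e q sᶜ) (he : 0 ≤ e) (hq : q ≤ 1) :
    ∑ i, x i ≤ Fintype.card ι * (q + 4 * e) := by
  have hcard : (s.card : ℝ) + sᶜ.card = Fintype.card ι := mod_cast s.card_add_card_compl
  have hmul : (Fintype.card ι : ℝ) * (e * q) ≤ Fintype.card ι * (e * 1) := by gcongr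
  rw [← Finset.sum_add_sum_compl s x]
  rw [← hcard] at hmul ⊢
  have hupper := add_le_add hs.2 hsc.2
  rw [← hcard] at hupper
  linarith

end ConcentratesOn

lemma sum_add_sum_min_le {ι : Type*} [Fintype ι] (x : ι → ℝ) (τ : ℝ) (T : Finset ι) :
    ∑ i ∈ T, x i + ∑ i, min (x i) τ ≤ ∑ i, x i + T.card * τ := by
  have hexcess : ∑ i ∈ T, (x i - min (x i) τ) ≤ ∑ i, (x i - min (x i) τ) :=
    Finset.sum_le_univ_sum_of_nonneg fun i => sub_nonneg.2 (min_le_left _ _)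
  have htrunc : ∑ i ∈ T, min (x i) τ ≤ T.card * τ :=
    (Finset.sum_le_card_nsmul _ _ _ fun i _ => min_le_right (x i) τ).trans_eq (nsmul_eq_mul _ _)
  rw [Finset.sum_sub_distrib, Finset.sum_sub_distrib] at hexcess
  linarith

variable {d n m : ℕ} [NeZero d] {k M b δ q : ℝ} {x : Fin n → ℝ}

/-- Removing `T` lowers the sum by at most its excess over the truncated sum, plus `τ #T`. -/
lemma sum_subset_le_rate (hk : k ≠ 0) (hM : 0 < M) (hb : 0 < b) (hδ : 0 < δ)
    (hδ' : δ ≤ 1 / 4) (hn0 : 0 < n) (hn : b ^ 2 * Real.log (2 * d / δ) ≤ n)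
    (hsum : ∑ i, x i ≤ n * (q + 4 * chernoffError d n b δ))
    (hmin : n * (q - truncationBias k M (pacBayesScale d n m k M b δ) (truncationLevel d n m k M δ))
      - Real.log (2 ^ d / δ) / pacBayesScale d n m k M b δ
        ≤ ∑ i, min (x i) (truncationLevel d n m k M δ))
    {T : Finset (Fin n)} (hT : T.card ≤ m) : ∑ i ∈ T, x i ≤ n * (31 * rate d n m k M b δ) := by
  have hδ1 : δ ≤ 1 := by linarith
  have hl := pacBayesScale_pos (d := d) (m := m) (k := k) hn0 hM hb hδ hδ1
  have hlog : Real.log (2 ^ d / δ) / pacBayesScale d n m k M b δ ≤ n * (4 * rate d n m k M b δ) :=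
    (div_le_div_of_nonneg_right (log_two_pow_div_le hδ) hl.le).trans
      (dim_add_log_div_pacBayesScale_le hn0 hM hb hδ hδ' hn)
  have hbias := mul_le_mul_of_nonneg_left
    (truncationBias_le_rate (d := d) (m := m) (b := b) hn0 hM hk hδ hδ1)
    (Nat.cast_nonneg (α := ℝ) n)
  have herr := mul_le_mul_of_nonneg_left
    (chernoffError_le_rate (n := n) (d := d) (m := m) (k := k) (M := M) (b := b) hδ hδ')
    (Nat.cast_nonneg (α := ℝ) n)
  have hTτ := card_mul_truncationLevel_le_rate (d := d) (k := k) (b := b) hn0 hM hδ hδ1 hT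
  have hsplit := sum_add_sum_min_le x (truncationLevel d n m k M δ) T
  have hrate : 0 ≤ n * rate d n m k M b δ := by
    have := max_dim_add_log_pos (d := d) m hδ hδ1
    rw [rate]
    positivity
  linarith

lemma sumResilient_of_concentratesOn (hk : k ≠ 0) (hM : 0 < M) (hb : 0 < b) (hδ : 0 < δ)
    (hδ' : δ ≤ 1 / 4) (hn100 : 100 ≤ n) (hn : 400 * (b ^ 2 * Real.log (2 * d / δ)) ≤ n)
    (hq : 2 / 3 ≤ q) (hq' : q ≤ 1) (h₁ : ConcentratesOn x (chernoffError d n b δ) q (half₁ n))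
    (h₂ : ConcentratesOn x (chernoffError d n b δ) q (half₂ n))
    (hmin : n * (q - truncationBias k M (pacBayesScale d n m k M b δ) (truncationLevel d n m k M δ))
      - Real.log (2 ^ d / δ) / pacBayesScale d n m k M b δ
        ≤ ∑ i, min (x i) (truncationLevel d n m k M δ)) :
    SumResilient x m (124 * rate d n m k M b δ) := by
  have hn0 : 0 < n := by omega
  have he := chernoffError_le_inv_twenty hn0 hn
  have he0 := chernoffError_nonneg (d := d) (n := n) (b := b) (δ := δ)
  have hc₁ := card_half_bounds hn100 (.inl rfl : half₁ n = half₁ n ∨ _)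
  have hc₂ := card_half_bounds hn100 (.inr rfl : _ ∨ half₂ n = half₂ n)
  have hcard := Fintype.card_fin n
  intro H hH
  have hquarter : n / 4 ≤ ∑ i ∈ H, x i := by
    have hconc : ConcentratesOn x (chernoffError d n b δ) q H := by
      rcases hH with rfl | rfl <;> assumption
    simpa only [hcard] using hconc.card_div_four_le_sum he hq
      (by simpa only [hcard] using (card_half_bounds hn100 hH).1)
  refine ⟨?_, fun T _ hT => ?_⟩
  · rcases hH with rfl | rfl
    · exact h₁.sum_le_three_quarters_mul h₂ he0 he hq (by simpa using hc₁.2)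
        (by rw [hcard]; exact hc₂.1)
    · exact h₂.sum_le_three_quarters_mul (by rwa [half₂, compl_compl]) he0 he hq
        (by simpa using hc₂.2) (by simpa [half₂] using hc₁.1)
  · have hrate : 0 ≤ rate d n m k M b δ := by
      have := max_dim_add_log_pos (d := d) m hδ (hδ'.trans (by norm_num))
      rw [rate]
      positivity
    calc ∑ i ∈ T, x i ≤ n * (31 * rate d n m k M b δ) :=
          sum_subset_le_rate hk hM hb hδ hδ' hn0 (by linarith)
            (by simpa only [hcard] using h₁.sum_univ_le h₂ he0 hq') hmin hT
      _ = 124 * rate d n m k M b δ * (n / 4) := by ring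
      _ ≤ 124 * rate d n m k M b δ * ∑ i ∈ H, x i := by gcongr

end ScalarResilience

section BoundedSample

variable {Ω : Type*} [MeasurableSpace Ω] {μ : Measure Ω} [IsProbabilityMeasure μ] {d : ℕ}
  {k M b δ : ℝ}

lemma rankOneFactor_le {t r : ℝ} (h0 : 0 ≤ t * r) (h1 : t * r ≤ 1) :
    rankOneFactor t r ≤ 1 + 2 * (t * r) := by
  rw [rankOneFactor, div_le_iff₀ (by linarith)]
  nlinarith

lemma one_sub_mul_le_rankOneFactor_neg {t r : ℝ} (h0 : 0 ≤ t * r) :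
    1 - t * r ≤ rankOneFactor (-t) r := by
  rw [rankOneFactor, le_div_iff₀ (by linarith)]
  nlinarith

section Chernoff

variable {κ : Type*} {Y : κ → Ω → E d} {N e η : ℝ}

/-- The Chernoff bound with `t = e / b²`. -/
lemma measureReal_exists_sum_inner_sq_gt_one_add_mul_le [NeZero d] (hYm : ∀ i, Measurable (Y i))
    (hYb : ∀ i, ∀ᵐ ω ∂μ, ‖Y i ω‖ ≤ b) (hind : iIndepFun Y μ) (hb : 0 < b) (he : 0 < e)
    (he1 : e ≤ 1) (s : Finset κ) (hη : 0 < η) (hN : b ^ 2 * Real.log (d / η) ≤ N * e ^ 2) :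
    μ.real {ω | ∃ v : E d, ‖v‖ = 1 ∧
      (1 + 2 * e) * ∑ i ∈ s, ∫ ω', inner ℝ v (Y i ω') ^ 2 ∂μ + N * e
        < ∑ i ∈ s, inner ℝ v (Y i ω) ^ 2} ≤ η := by
  have ht : 0 < e / b ^ 2 := by positivity
  have htb : e / b ^ 2 * b ^ 2 = e := div_mul_cancel₀ _ (by positivity)
  have hlog : Real.log (d / η) ≤ e / b ^ 2 * (N * e) := by
    rw [div_mul_eq_mul_div, le_div_iff₀ (by positivity)]
    linarith
  refine (measureReal_mono ?_).trans (measureReal_exists_sum_inner_sq_gt_le hYm hYb hind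
    (t := e / b ^ 2) (by rw [abs_of_pos ht, htb]; linarith) s hη)
  rintro ω ⟨v, hv, hlt⟩
  refine ⟨v, ?_⟩
  have hfactor := rankOneFactor_le (htb.symm ▸ he.le) (htb.trans_le he1)
  rw [htb] at hfactor
  calc _ ≤ (1 + 2 * e) * (e / b ^ 2) * ∑ i ∈ s, ∫ ω', inner ℝ v (Y i ω') ^ 2 ∂μ
        + e / b ^ 2 * (N * e) * ‖v‖ ^ 2 := by gcongr
    _ = e / b ^ 2 * ((1 + 2 * e) * ∑ i ∈ s, ∫ ω', inner ℝ v (Y i ω') ^ 2 ∂μ + N * e) := by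
        rw [hv]
        ring
    _ < _ := by gcongr

lemma measureReal_exists_sum_inner_sq_lt_one_sub_mul_le [NeZero d] (hYm : ∀ i, Measurable (Y i))
    (hYb : ∀ i, ∀ᵐ ω ∂μ, ‖Y i ω‖ ≤ b) (hind : iIndepFun Y μ) (hb : 0 < b) (he : 0 < e)
    (he1 : e ≤ 1) (s : Finset κ) (hη : 0 < η) (hN : b ^ 2 * Real.log (d / η) ≤ N * e ^ 2) :
    μ.real {ω | ∃ v : E d, ‖v‖ = 1 ∧ ∑ i ∈ s, inner ℝ v (Y i ω) ^ 2 <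
      (1 - e) * ∑ i ∈ s, ∫ ω', inner ℝ v (Y i ω') ^ 2 ∂μ - N * e} ≤ η := by
  have ht : 0 < e / b ^ 2 := by positivity
  have htb : e / b ^ 2 * b ^ 2 = e := div_mul_cancel₀ _ (by positivity)
  have hlog : Real.log (d / η) ≤ e / b ^ 2 * (N * e) := by
    rw [div_mul_eq_mul_div, le_div_iff₀ (by positivity)]
    linarith
  refine (measureReal_mono ?_).trans (measureReal_exists_sum_inner_sq_gt_le hYm hYb hind
    (t := -(e / b ^ 2)) (by rw [abs_neg, abs_of_pos ht, htb]; linarith) s hη)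
  rintro ω ⟨v, hv, hlt⟩
  refine ⟨v, ?_⟩
  have hfactor := one_sub_mul_le_rankOneFactor_neg (htb.symm ▸ he.le)
  rw [htb] at hfactor
  have hmain : e / b ^ 2 * ((1 - e) * ∑ i ∈ s, ∫ ω', inner ℝ v (Y i ω') ^ 2 ∂μ)
      ≤ e / b ^ 2 * (rankOneFactor (-(e / b ^ 2)) (b ^ 2) *
        ∑ i ∈ s, ∫ ω', inner ℝ v (Y i ω') ^ 2 ∂μ) := by gcongr
  rw [hv]
  linarith [mul_lt_mul_of_pos_left hlt ht]

lemma measureReal_exists_not_concentratesOn_le [NeZero d] [Fintype κ] {Q : E d → ℝ}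
    (hYm : ∀ i, Measurable (Y i)) (hYb : ∀ i, ∀ᵐ ω ∂μ, ‖Y i ω‖ ≤ b) (hind : iIndepFun Y μ)
    (hQ : ∀ i v, ∫ ω, inner ℝ v (Y i ω) ^ 2 ∂μ = Q v) (hb : 0 < b) (he : 0 < e) (he1 : e ≤ 1)
    (s : Finset κ) (hη : 0 < η) (hN : b ^ 2 * Real.log (2 * d / η) ≤ Fintype.card κ * e ^ 2) :
    μ.real {ω | ∃ v : E d, ‖v‖ = 1 ∧
      ¬ ConcentratesOn (fun i => inner ℝ v (Y i ω) ^ 2) e (Q v) s} ≤ η := by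
  rw [show 2 * d / η = d / (η / 2) by field_simp] at hN
  have hlower := measureReal_exists_sum_inner_sq_lt_one_sub_mul_le hYm hYb hind hb he he1 s
    (half_pos hη) hN
  have hupper := measureReal_exists_sum_inner_sq_gt_one_add_mul_le hYm hYb hind hb he he1 s
    (half_pos hη) hN
  refine (measureReal_mono ?_).trans ((measureReal_union_le _ _).trans
    ((add_le_add hlower hupper).trans_eq (add_halves η)))
  rintro ω ⟨v, hv, hconc⟩
  simp only [hQ, Finset.sum_const, nsmul_eq_mul]
  rw [ConcentratesOn, not_and_or, not_le, not_le] at hconc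
  refine hconc.imp (fun h => ⟨v, hv, h.trans_eq ?_⟩) (fun h => ⟨v, hv, h.trans_eq' ?_⟩) <;> ring

end Chernoff

lemma integral_inner_sq_le_sq_mul {y : Ω → E d} (hym : Measurable y) (hyb : ∀ᵐ ω ∂μ, ‖y ω‖ ≤ b)
    (v : E d) : ∫ ω, inner ℝ v (y ω) ^ 2 ∂μ ≤ (‖v‖ * b) ^ 2 := by
  have hint : Integrable (fun ω => inner ℝ v (y ω) ^ 2) μ :=
    integrable_comp_of_ae_norm_le hym hyb (f := fun x => inner ℝ v x ^ 2) (by fun_prop)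
  have hle : ∫ ω, inner ℝ v (y ω) ^ 2 ∂μ ≤ ∫ _, (‖v‖ * b) ^ 2 ∂μ := by
    refine integral_mono_ae hint (integrable_const _) ?_
    filter_upwards [hyb] with ω hω
    rw [← sq_abs]
    gcongr
    exact (abs_real_inner_le_norm v _).trans (by gcongr)
  simpa using hle

lemma integral_inner_sq_le_sq_mul_of_moment {y : Ω → E d} (hym : Measurable y)
    (hyb : ∀ᵐ ω ∂μ, ‖y ω‖ ≤ b) (hk : 2 ≤ k) (hM : 0 ≤ M) {v : E d}
    (hmom : ∫ ω, |inner ℝ v (y ω)| ^ k ∂μ ≤ (M * ‖v‖) ^ k) :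
    ∫ ω, inner ℝ v (y ω) ^ 2 ∂μ ≤ (M * ‖v‖) ^ 2 := by
  have hint {p : ℝ} (hp : 0 ≤ p) : Integrable (fun ω => |inner ℝ v (y ω)| ^ p) μ :=
    integrable_comp_of_ae_norm_le hym hyb (f := fun x => |inner ℝ v x| ^ p)
      ((by fun_prop : Continuous fun x : E d => |inner ℝ v x|).rpow_const fun _ => .inr hp)
  have := integral_abs_rpow_le_rpow_of_le two_pos hk (by positivity) (hint zero_le_two)
    (hint (by linarith)) hmom
  simpa only [Real.rpow_two, sq_abs] using this

variable {n m : ℕ} {Y : Fin n → Ω → E d} {Q : E d → ℝ}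

lemma hundred_le_and_moment_pos [NeZero d] (hYm : ∀ i, Measurable (Y i))
    (hYb : ∀ i, ∀ᵐ ω ∂μ, ‖Y i ω‖ ≤ b) (hQ : ∀ i v, ∫ ω, inner ℝ v (Y i ω) ^ 2 ∂μ = Q v)
    (hk : 2 ≤ k) (hM : 0 ≤ M) (hb : 0 < b)
    (hmom : ∀ i, ∀ w : E d, ∫ ω, |inner ℝ w (Y i ω)| ^ k ∂μ ≤ (M * ‖w‖) ^ k)
    (hδ : 0 < δ) (hδ' : δ ≤ 1 / 4) (hn : 400 * (b ^ 2 * Real.log (2 * d / δ)) ≤ n) {v : E d}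
    (hv : ‖v‖ = 1) (hQv : 2 / 3 ≤ Q v) : 100 ≤ n ∧ 0 < M := by
  have hlog := two_le_log_two_mul_div (d := d) hδ hδ'
  have hn0 : 0 < n := by
    have : (0 : ℝ) < n := by
      refine lt_of_lt_of_le ?_ hn
      positivity
    exact_mod_cast this
  let i : Fin n := ⟨0, hn0⟩
  have hb2 := integral_inner_sq_le_sq_mul (hYm i) (hYb i) v
  have hM2 := integral_inner_sq_le_sq_mul_of_moment (hYm i) (hYb i) hk hM (hmom i v)
  rw [hQ, hv, one_mul] at hb2
  rw [hQ, hv, mul_one] at hM2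
  refine ⟨?_, hM.lt_of_ne' fun hM0 => by norm_num [hM0] at hM2; linarith⟩
  have : (100 : ℝ) ≤ n := by nlinarith
  exact_mod_cast this

/-- Either some unit vector `v` has `Q v ≥ 2/3`, and then `n` and `M` are bounded below, or the
event is empty. -/
theorem measureReal_exists_not_sumResilient_le [NeZero d] (hYm : ∀ i, Measurable (Y i))
    (hYb : ∀ i, ∀ᵐ ω ∂μ, ‖Y i ω‖ ≤ b) (hind : iIndepFun Y μ)
    (hQ : ∀ i v, ∫ ω, inner ℝ v (Y i ω) ^ 2 ∂μ = Q v) (hk : 4 ≤ k) (hM : 0 ≤ M) (hb : 0 < b)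
    (hmom : ∀ i, ∀ w : E d, ∫ ω, |inner ℝ w (Y i ω)| ^ k ∂μ ≤ (M * ‖w‖) ^ k)
    (hδ : 0 < δ) (hδ' : δ ≤ 1 / 4) (hn : 400 * (b ^ 2 * Real.log (2 * d / δ)) ≤ n) :
    μ.real {ω | ∃ v : E d, ‖v‖ = 1 ∧ 2 / 3 ≤ Q v ∧ Q v ≤ 1 ∧
      ¬ SumResilient (fun i => inner ℝ v (Y i ω) ^ 2) m (124 * rate d n m k M b δ)}
      ≤ 3 * δ := by
  by_cases hex : ∃ v : E d, ‖v‖ = 1 ∧ 2 / 3 ≤ Q v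
  swap
  · refine (measureReal_mono_null (Set.subset_empty_iff.2 <| Set.eq_empty_of_forall_notMem
      fun ω hω => hex (hω.imp fun v hv => ⟨hv.1, hv.2.1⟩)) measureReal_empty).trans_le ?_
    positivity
  obtain ⟨v₀, hv₀, hQv₀⟩ := hex
  obtain ⟨hn100, hM0⟩ := hundred_le_and_moment_pos hYm hYb hQ (by linarith) hM hb hmom hδ hδ' hn
    hv₀ hQv₀
  have hn0 : 0 < n := by omega
  have hδ1 : δ ≤ 1 := by linarith
  have hlog := two_le_log_two_mul_div (d := d) hδ hδ'
  have he : 0 < chernoffError d n b δ := Real.sqrt_pos.2 (by positivity)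
  have hN : b ^ 2 * Real.log (2 * d / δ) ≤ Fintype.card (Fin n) * chernoffError d n b δ ^ 2 := by
    rw [sq_chernoffError hδ hδ', Fintype.card_fin, mul_div_cancel₀ _ (by positivity)]
  have hconc := measureReal_exists_not_concentratesOn_le hYm hYb hind hQ hb he
    ((chernoffError_le_inv_twenty hn0 hn).trans (by norm_num)) (hη := hδ) (hN := hN)
  have hpac := measureReal_exists_sum_min_inner_sq_lt_le hYm hYb hind hk hM
    (pacBayesScale_pos (d := d) (m := m) (k := k) hn0 hM0 hb hδ hδ1)
    (truncationLevel_pos hn0 hM0 hδ hδ1) (pacBayesScale_mul_truncationLevel_le_one hn0 hM0 hδ hδ1)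
    (by simpa using pacBayesScale_mul_sq_le hb) hmom hδ
  refine (measureReal_mono ?_).trans ((measureReal_union_le _ _).trans (add_le_add
    ((measureReal_union_le _ _).trans (add_le_add (hconc (half₁ n)) (hconc (half₂ n)))) hpac)
    |>.trans_eq (by ring))
  rintro ω ⟨v, hv, hQv, hQv', hres⟩
  by_contra! hω
  simp only [Set.mem_union, Set.mem_ofPred_eq, not_or, not_exists, not_and, not_not, not_lt] at hω
  obtain ⟨⟨h₁, h₂⟩, hmin⟩ := hω
  refine hres (sumResilient_of_concentratesOn (by linarith) hM0 hb hδ hδ' hn100 hn hQv hQv'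
    (h₁ v hv) (h₂ v hv) ?_)
  simpa only [hQ, Finset.sum_const, Finset.card_univ, Fintype.card_fin, nsmul_eq_mul,
    finrank_euclideanSpace_fin] using hmin v hv.le

end BoundedSample

section Whitening

open Matrix

variable {d : ℕ} {S : Matrix (Fin d) (Fin d) ℝ}

/-- The vector `f(S) z`, with `f(S)` the continuous functional calculus. Whitening is the case
`f x = 1 / √x`. -/
noncomputable def cfcMulVec (f : ℝ → ℝ) (S : Matrix (Fin d) (Fin d) ℝ) (z : E d) : E d :=
  WithLp.toLp 2 (cfc f S *ᵥ z.ofLp)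

lemma whiten_eq_cfcMulVec (z : E d) : whiten S z = cfcMulVec (fun x => (√x)⁻¹) S z := rfl

lemma cfcMulVec_smul (f : ℝ → ℝ) (t : ℝ) (z : E d) :
    cfcMulVec f S (t • z) = t • cfcMulVec f S z := by
  simp only [cfcMulVec, WithLp.ofLp_smul, mulVec_smul, WithLp.toLp_smul]

lemma cfcMulVec_cfcMulVec (f g : ℝ → ℝ) (z : E d) :
    cfcMulVec f S (cfcMulVec g S z) = cfcMulVec (fun x => f x * g x) S z := by
  simp only [cfcMulVec, mulVec_mulVec]
  rw [cfc_mul f g S (finite_real_spectrum.continuousOn f) (finite_real_spectrum.continuousOn g)]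

lemma sub_cfcMulVec (hS : S.IsHermitian) (f : ℝ → ℝ) (z : E d) :
    z - cfcMulVec f S z = cfcMulVec (fun x => 1 - f x) S z := by
  have hone : cfc (fun _ : ℝ => (1 : ℝ)) S = 1 := cfc_const_one ℝ S hS
  rw [cfcMulVec, cfcMulVec, cfc_sub _ _ S (finite_real_spectrum.continuousOn _)
    (finite_real_spectrum.continuousOn f), hone, sub_mulVec, one_mulVec, WithLp.toLp_sub]

lemma inner_cfcMulVec (f : ℝ → ℝ) (u z : E d) :
    inner ℝ u (cfcMulVec f S z) = inner ℝ (cfcMulVec f S u) z := by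
  have hsymm : (cfc f S)ᵀ = cfc f S := by
    rw [← conjTranspose_eq_transpose_of_trivial]
    exact (cfc_predicate f S : IsSelfAdjoint (cfc f S))
  rw [inner_eq_dotProduct, inner_eq_dotProduct, cfcMulVec, cfcMulVec, dotProduct_mulVec,
    ← mulVec_transpose, hsymm]

lemma continuous_whiten (S : Matrix (Fin d) (Fin d) ℝ) : Continuous (whiten S) := by
  unfold whiten
  fun_prop

variable {P : Measure (E d)}

lemma posSemidef_secondMoment (hP : MemLp (fun z : E d => z) 2 P) :
    (secondMoment P).PosSemidef := by
  refine .of_dotProduct_mulVec_nonneg (isHermitian_secondMoment P) fun x => ?_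
  rw [star_trivial, dotProduct_secondMoment_mulVec hP (WithLp.toLp 2 x)]
  positivity

lemma integral_inner_cfcMulVec_sq (hP : MemLp (fun z : E d => z) 2 P) (f : ℝ → ℝ) (u : E d) :
    ∫ z, inner ℝ (cfcMulVec f (secondMoment P) u) z ^ 2 ∂P =
      inner ℝ u (cfcMulVec (fun x => f x * (x * f x)) (secondMoment P) u) := by
  have hid (w : E d) : cfcMulVec (fun x => x) (secondMoment P) w =
      WithLp.toLp 2 (secondMoment P *ᵥ w.ofLp) :=
    congrArg (fun A => WithLp.toLp 2 (A *ᵥ w.ofLp)) (cfc_id' ℝ _ (isHermitian_secondMoment P))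
  rw [← cfcMulVec_cfcMulVec f, ← cfcMulVec_cfcMulVec, inner_cfcMulVec, hid,
    inner_eq_dotProduct, dotProduct_secondMoment_mulVec hP]

lemma ae_cfcMulVec_eq_zero (hP : MemLp (fun z : E d => z) 2 P) {f : ℝ → ℝ}
    (hf : ∀ x, 0 ≤ x → x * f x = 0) : ∀ᵐ z ∂P, cfcMulVec f (secondMoment P) z = 0 := by
  have hzero : cfc (fun x => f x * (x * f x)) (secondMoment P) = 0 := by
    rw [← cfc_zero ℝ (secondMoment P)]
    refine cfc_congr fun x hx => ?_
    rw [hf x ((posSemidef_iff_isHermitian_and_spectrum_nonneg.1 (posSemidef_secondMoment hP)).2 hx),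
      mul_zero, Pi.zero_apply]
  have hcoord (u : E d) : ∀ᵐ z ∂P, inner ℝ u (cfcMulVec f (secondMoment P) z) = 0 := by
    have hint := integral_inner_cfcMulVec_sq hP f u
    rw [cfcMulVec, cfcMulVec, hzero, zero_mulVec, WithLp.toLp_zero, inner_zero_right] at hint
    rw [integral_eq_zero_iff_of_nonneg (fun z => sq_nonneg _)
      (hP.const_inner _).integrable_sq] at hint
    filter_upwards [hint] with z hz
    rw [inner_cfcMulVec]
    exact pow_eq_zero_iff two_ne_zero |>.1 hz
  filter_upwards [ae_all_iff.2 fun i => hcoord (EuclideanSpace.single i 1)] with z hz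
  ext i
  simpa [EuclideanSpace.inner_single_left] using hz i

lemma ae_cfcMulVec_sqrt_whiten (hP : MemLp (fun z : E d => z) 2 P) :
    ∀ᵐ z ∂P, cfcMulVec Real.sqrt (secondMoment P) (whiten (secondMoment P) z) = z := by
  have hnull := ae_cfcMulVec_eq_zero hP (f := fun x => 1 - √x * (√x)⁻¹) fun x hx => by
    rcases hx.eq_or_lt with rfl | hx
    · simp
    · rw [mul_inv_cancel₀ (Real.sqrt_pos.2 hx).ne', sub_self, mul_zero]
  filter_upwards [hnull] with z hz
  rw [← sub_cfcMulVec (isHermitian_secondMoment P), sub_eq_zero] at hz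
  rw [whiten_eq_cfcMulVec, cfcMulVec_cfcMulVec, ← hz]

/-- The whitened vector is isotropic only on the range of `S^{1/2}`, since `S` may be singular. -/
lemma integral_inner_cfcMulVec_sqrt_whiten_sq (hP : MemLp (fun z : E d => z) 2 P) (u : E d) :
    ∫ z, inner ℝ (cfcMulVec Real.sqrt (secondMoment P) u) (whiten (secondMoment P) z) ^ 2 ∂P =
      ‖cfcMulVec Real.sqrt (secondMoment P) u‖ ^ 2 := by
  simp only [whiten_eq_cfcMulVec, inner_cfcMulVec, cfcMulVec_cfcMulVec]
  rw [integral_inner_cfcMulVec_sq hP, ← real_inner_self_eq_norm_sq, ← inner_cfcMulVec,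
    cfcMulVec_cfcMulVec]
  congr 2
  ext x
  rcases le_or_gt x 0 with hx | hx
  · simp [Real.sqrt_eq_zero_of_nonpos hx]
  · have := Real.sqrt_pos.2 hx
    rw [inv_mul_cancel₀ this.ne', mul_one, one_mul, Real.mul_self_sqrt hx.le]

end Whitening

section Moments

variable {α : Type*} [MeasurableSpace α] {ρ : Measure α} {f : α → ℝ} {p M : ℝ}

lemma integral_abs_rpow_le_of_eLpNorm_le (hf : AEStronglyMeasurable f ρ) (hp : 0 < p)
    (hM : 0 ≤ M) (h : eLpNorm f (ENNReal.ofReal p) ρ ≤ ENNReal.ofReal M) :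
    ∫ x, |f x| ^ p ∂ρ ≤ M ^ p := by
  have hL : MemLp f (ENNReal.ofReal p) ρ := ⟨hf, h.trans_lt ENNReal.ofReal_lt_top⟩
  rw [hL.eLpNorm_eq_integral_rpow_norm (by simpa using hp) ENNReal.ofReal_ne_top,
    ENNReal.ofReal_le_ofReal_iff hM, ENNReal.toReal_ofReal hp.le] at h
  exact (Real.rpow_inv_le_iff_of_pos (by positivity) hM hp).1 h

lemma setIntegral_sq_le_of_eLpNorm_le [IsFiniteMeasure ρ] (hf : AEStronglyMeasurable f ρ)
    (hp : 2 ≤ p) (hM : 0 ≤ M) (h : eLpNorm f (ENNReal.ofReal p) ρ ≤ ENNReal.ofReal M)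
    (s : Set α) : ∫ x in s, f x ^ 2 ∂ρ ≤ M ^ 2 * ρ.real s ^ (1 - 2 / p) := by
  have hexp : 0 ≤ 1 / 2 - 1 / p := sub_nonneg.2 (one_div_le_one_div_of_le two_pos hp)
  have hL2 : eLpNorm f (ENNReal.ofReal 2) (ρ.restrict s) ≤
      ENNReal.ofReal (M * ρ.real s ^ (1 / 2 - 1 / p)) :=
    calc eLpNorm f (ENNReal.ofReal 2) (ρ.restrict s)
        ≤ eLpNorm f (ENNReal.ofReal p) (ρ.restrict s) *
          (ρ.restrict s) Set.univ ^
            (1 / (ENNReal.ofReal 2).toReal - 1 / (ENNReal.ofReal p).toReal) :=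
          eLpNorm_le_eLpNorm_mul_rpow_measure_univ (ENNReal.ofReal_le_ofReal hp) hf.restrict
      _ ≤ ENNReal.ofReal M * ENNReal.ofReal (ρ.real s ^ (1 / 2 - 1 / p)) := by
          rw [Measure.restrict_apply_univ, ENNReal.toReal_ofReal zero_le_two,
            ENNReal.toReal_ofReal (by linarith),
            ← ENNReal.ofReal_rpow_of_nonneg measureReal_nonneg hexp, ofReal_measureReal]
          gcongr
          exact (eLpNorm_mono_measure f Measure.restrict_le_self).trans h
      _ = ENNReal.ofReal (M * ρ.real s ^ (1 / 2 - 1 / p)) := (ENNReal.ofReal_mul hM).symm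
  calc ∫ x in s, f x ^ 2 ∂ρ
      ≤ (M * ρ.real s ^ (1 / 2 - 1 / p)) ^ (2 : ℝ) := by
        simpa only [Real.rpow_two, sq_abs] using
          integral_abs_rpow_le_of_eLpNorm_le hf.restrict two_pos (by positivity) hL2
    _ = M ^ 2 * ρ.real s ^ (1 - 2 / p) := by
        rw [Real.mul_rpow hM (by positivity), Real.rpow_two, ← Real.rpow_mul measureReal_nonneg]
        ring_nf

end Moments

section Clipping

variable {d : ℕ} {P : Measure (E d)} {S : Matrix (Fin d) (Fin d) ℝ} {k M b : ℝ}
  {clip : E d → E d}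

lemma MomentBound.eLpNorm_inner_whiten_le (hmom : MomentBound P k M) (w : E d) :
    eLpNorm (fun z => inner ℝ w (whiten (secondMoment P) z)) (ENNReal.ofReal k) P
      ≤ ENNReal.ofReal (M * ‖w‖) := by
  rcases eq_or_ne w 0 with rfl | hw
  · simp
  have hscale : (fun z => inner ℝ w (whiten (secondMoment P) z)) =
      ‖w‖ • fun z => inner ℝ (‖w‖⁻¹ • w) (whiten (secondMoment P) z) := by
    ext z
    rw [Pi.smul_apply, smul_eq_mul, real_inner_smul_left,
      mul_inv_cancel_left₀ (norm_ne_zero_iff.2 hw)]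
  rw [hscale, eLpNorm_const_smul, mul_comm M, ENNReal.ofReal_mul (norm_nonneg w), enorm_norm,
    ofReal_norm]
  gcongr
  exact hmom _ (norm_smul_inv_norm hw)

lemma IsClipping.exists_smul (h : IsClipping S b clip) (z : E d) :
    ∃ t : ℝ, 0 ≤ t ∧ t ≤ 1 ∧ clip z = t • z := by
  rcases le_or_gt (mnorm S z) b with hz | hz
  · exact ⟨1, zero_le_one, le_rfl, by rw [h.2.1 z hz, one_smul]⟩
  · obtain ⟨t, ht₀, ht₁, hclip, -⟩ := h.2.2 z hz
    exact ⟨t, ht₀, ht₁, hclip⟩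

lemma IsClipping.norm_whiten_le (h : IsClipping S b clip) (z : E d) : ‖whiten S (clip z)‖ ≤ b := by
  rcases le_or_gt (mnorm S z) b with hz | hz
  · rwa [h.2.1 z hz]
  · obtain ⟨-, -, -, -, hnorm⟩ := h.2.2 z hz
    exact hnorm

lemma IsClipping.abs_inner_whiten_le (h : IsClipping S b clip) (w z : E d) :
    |inner ℝ w (whiten S (clip z))| ≤ |inner ℝ w (whiten S z)| := by
  obtain ⟨t, ht₀, ht₁, hclip⟩ := h.exists_smul z
  rw [hclip, whiten_eq_cfcMulVec, cfcMulVec_smul, real_inner_smul_right, abs_mul,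
    abs_of_nonneg ht₀]
  exact mul_le_of_le_one_left (abs_nonneg _) ht₁

lemma IsClipping.cfcMulVec_sqrt_whiten (h : IsClipping S b clip) {z : E d}
    (hz : cfcMulVec Real.sqrt S (whiten S z) = z) :
    cfcMulVec Real.sqrt S (whiten S (clip z)) = clip z := by
  obtain ⟨t, -, -, hclip⟩ := h.exists_smul z
  rw [hclip, whiten_eq_cfcMulVec, cfcMulVec_smul, cfcMulVec_smul, ← whiten_eq_cfcMulVec, hz]

lemma IsClipping.measurable_whiten (h : IsClipping S b clip) :
    Measurable fun z => whiten S (clip z) :=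
  (continuous_whiten S).measurable.comp h.1

lemma IsClipping.measurable_inner_whiten (h : IsClipping S b clip) (w : E d) :
    Measurable fun z => (inner ℝ w (whiten S (clip z)) : ℝ) :=
  measurable_const.inner h.measurable_whiten

lemma IsClipping.integral_abs_inner_whiten_rpow_le (hclip : IsClipping (secondMoment P) b clip)
    (hmom : MomentBound P k M) (hk : 0 < k) (hM : 0 ≤ M) (w : E d) :
    ∫ z, |inner ℝ w (whiten (secondMoment P) (clip z))| ^ k ∂P ≤ (M * ‖w‖) ^ k :=
  integral_abs_rpow_le_of_eLpNorm_le (hclip.measurable_inner_whiten w).aestronglyMeasurable hk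
    (by positivity) <| (eLpNorm_mono (hclip.abs_inner_whiten_le w)).trans
      (hmom.eLpNorm_inner_whiten_le w)

lemma integrable_inner_whiten_sq (hP : MemLp (fun z : E d => z) 2 P) (w : E d) :
    Integrable (fun z => inner ℝ w (whiten S z) ^ 2) P := by
  simp only [whiten_eq_cfcMulVec, inner_cfcMulVec]
  exact (hP.const_inner _).integrable_sq

lemma IsClipping.integrable_inner_whiten_sq (h : IsClipping S b clip)
    (hP : MemLp (fun z : E d => z) 2 P) (w : E d) :
    Integrable (fun z => inner ℝ w (whiten S (clip z)) ^ 2) P :=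
  (HeavyTail.integrable_inner_whiten_sq hP w).mono
    ((h.measurable_inner_whiten w).pow_const 2).aestronglyMeasurable
    (.of_forall fun z => by simpa using sq_le_sq.2 (h.abs_inner_whiten_le w z))

lemma IsClipping.integral_inner_whiten_sq_le (h : IsClipping S b clip)
    (hP : MemLp (fun z : E d => z) 2 P) (w : E d) :
    ∫ z, inner ℝ w (whiten S (clip z)) ^ 2 ∂P ≤ ∫ z, inner ℝ w (whiten S z) ^ 2 ∂P :=
  integral_mono (h.integrable_inner_whiten_sq hP w) (HeavyTail.integrable_inner_whiten_sq hP w)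
    fun z => sq_le_sq.2 (h.abs_inner_whiten_le w z)

lemma IsClipping.integral_inner_whiten_sq_sub_setIntegral_le (h : IsClipping S b clip)
    (hP : MemLp (fun z : E d => z) 2 P) (w : E d) :
    ∫ z, inner ℝ w (whiten S z) ^ 2 ∂P
        - ∫ z in {z | b < mnorm S z}, inner ℝ w (whiten S z) ^ 2 ∂P
      ≤ ∫ z, inner ℝ w (whiten S (clip z)) ^ 2 ∂P := by
  have hs : MeasurableSet {z | b < mnorm S z} :=
    measurableSet_lt measurable_const (continuous_mnorm S).measurable
  calc ∫ z, inner ℝ w (whiten S z) ^ 2 ∂P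
        - ∫ z in {z | b < mnorm S z}, inner ℝ w (whiten S z) ^ 2 ∂P
      = ∫ z in {z | b < mnorm S z}ᶜ, inner ℝ w (whiten S z) ^ 2 ∂P := by
        rw [setIntegral_compl hs (HeavyTail.integrable_inner_whiten_sq hP w)]
    _ = ∫ z in {z | b < mnorm S z}ᶜ, inner ℝ w (whiten S (clip z)) ^ 2 ∂P :=
        setIntegral_congr_fun hs.compl fun z hz => by simp only [h.2.1 z (not_lt.1 hz)]
    _ ≤ ∫ z, inner ℝ w (whiten S (clip z)) ^ 2 ∂P :=
        setIntegral_le_integral (h.integrable_inner_whiten_sq hP w)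
          (.of_forall fun z => sq_nonneg _)

lemma IsClipping.two_thirds_mul_sq_norm_le [IsFiniteMeasure P]
    (hclip : IsClipping (secondMoment P) b clip) (hP : MemLp (fun z : E d => z) 2 P)
    (hmom : MomentBound P k M) (hk : 2 ≤ k) (hM : 0 ≤ M)
    (hrare : 3 * M ^ 2 * P.real {z | b < mnorm (secondMoment P) z} ^ (1 - 2 / k) ≤ 1) {w : E d}
    (hw : ∫ z, inner ℝ w (whiten (secondMoment P) z) ^ 2 ∂P = ‖w‖ ^ 2) :
    2 / 3 * ‖w‖ ^ 2 ≤ ∫ z, inner ℝ w (whiten (secondMoment P) (clip z)) ^ 2 ∂P := by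
  have hloss := setIntegral_sq_le_of_eLpNorm_le
    (f := fun z => inner ℝ w (whiten (secondMoment P) z))
    ((continuous_const.inner (continuous_whiten _)).aestronglyMeasurable) hk
    (by positivity) (hmom.eLpNorm_inner_whiten_le w) {z | b < mnorm (secondMoment P) z}
  have hclipped := hclip.integral_inner_whiten_sq_sub_setIntegral_le hP w
  have hrare' := mul_le_mul_of_nonneg_right hrare (sq_nonneg ‖w‖)
  linarith

end Clipping

section Resilience

open Matrix

variable {n d m : ℕ} {α : ℝ}

lemma dotProduct_scov_mulVec (z : Fin n → E d) (I : Finset (Fin n)) (u : E d) :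
    u.ofLp ⬝ᵥ (scov z I *ᵥ u.ofLp) = 1 / n * ∑ i ∈ I, inner ℝ u (z i) ^ 2 := by
  simp only [scov, smul_mulVec, dotProduct_smul, sum_mulVec, dotProduct_sum, smul_eq_mul,
    dotProduct_vecMulVec_self_mulVec]

lemma isHermitian_scov (z : Fin n → E d) (I : Finset (Fin n)) : (scov z I).IsHermitian :=
  .ext fun i j => by simp [scov, Matrix.sum_apply, vecMulVec_apply, mul_comm]

lemma posSemidef_smul_scov_sub_scov {z : Fin n → E d} {I J : Finset (Fin n)} {c : ℝ}
    (h : ∀ u : E d, ∑ i ∈ J, inner ℝ u (z i) ^ 2 ≤ c * ∑ i ∈ I, inner ℝ u (z i) ^ 2) :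
    (c • scov z I - scov z J).PosSemidef := by
  refine .of_dotProduct_mulVec_nonneg
    (((isHermitian_scov z I).smul (.all c)).sub (isHermitian_scov z J)) fun x => ?_
  have hquad := dotProduct_scov_mulVec z (u := WithLp.toLp 2 x)
  rw [star_trivial, sub_mulVec, smul_mulVec, dotProduct_sub, dotProduct_smul, hquad, hquad,
    smul_eq_mul, mul_left_comm, ← mul_sub]
  exact mul_nonneg (by positivity) (sub_nonneg.2 (h _))

lemma opNormResilient_of_forall_sumResilient {z : Fin n → E d}
    (h : ∀ u : E d, SumResilient (fun i => inner ℝ u (z i) ^ 2) m α) : OpNormResilient z m α :=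
  fun H hH => ⟨posSemidef_smul_scov_sub_scov fun u => (h u H hH).1,
    fun T hTH hT => posSemidef_smul_scov_sub_scov fun u => (h u H hH).2 T hTH hT⟩

lemma sumResilient_inner_sq_of_forall_norm_eq_one {y : Fin n → E d} {Q : E d → ℝ} {c₁ c₂ : ℝ}
    (hQ : ∀ (c : ℝ) v, Q (c • v) = c ^ 2 * Q v)
    (h : ∀ v : E d, ‖v‖ = 1 → c₁ ≤ Q v → Q v ≤ c₂ →
      SumResilient (fun i => inner ℝ v (y i) ^ 2) m α)
    {w : E d} (hw₁ : c₁ * ‖w‖ ^ 2 ≤ Q w) (hw₂ : Q w ≤ c₂ * ‖w‖ ^ 2) :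
    SumResilient (fun i => inner ℝ w (y i) ^ 2) m α := by
  rcases eq_or_ne w 0 with rfl | hw
  · simp [SumResilient]
  have hw0 : 0 < ‖w‖ ^ 2 := by positivity
  have hQv : Q (‖w‖⁻¹ • w) = Q w / ‖w‖ ^ 2 := by rw [hQ, inv_pow, inv_mul_eq_div]
  have hunit := h (‖w‖⁻¹ • w) (norm_smul_inv_norm hw) (hQv ▸ (le_div_iff₀ hw0).2 hw₁)
    (hQv ▸ (div_le_iff₀ hw0).2 hw₂)
  convert hunit.const_mul hw0.le using 2 with i
  rw [real_inner_smul_left]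
  field_simp

end Resilience

section Sample

variable {Ω : Type*} [MeasurableSpace Ω] {μ : Measure Ω} [IsProbabilityMeasure μ] {d n m : ℕ}
  {k M b δ : ℝ} {P : Measure (E d)} {clip : E d → E d} {Z : Fin n → Ω → E d}

/-- A vector `u` sees `clip z` as `S^{1/2} u` sees the whitened `clip z`, because `z` lies in the
range of `S` almost surely. -/
lemma IsClipping.opNormResilient_of_forall_norm_eq_one [IsProbabilityMeasure P]
    (hclip : IsClipping (secondMoment P) b clip) (hP : MemLp (fun z : E d => z) 2 P)
    (hmom : MomentBound P k M) (hk : 2 ≤ k) (hM : 0 ≤ M)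
    (hrare : 3 * M ^ 2 * P.real {z | b < mnorm (secondMoment P) z} ^ (1 - 2 / k) ≤ 1)
    {z : Fin n → E d} {α : ℝ}
    (hz : ∀ i, cfcMulVec Real.sqrt (secondMoment P) (whiten (secondMoment P) (z i)) = z i)
    (h : ∀ v : E d, ‖v‖ = 1 →
      2 / 3 ≤ ∫ x, inner ℝ v (whiten (secondMoment P) (clip x)) ^ 2 ∂P →
      ∫ x, inner ℝ v (whiten (secondMoment P) (clip x)) ^ 2 ∂P ≤ 1 →
      SumResilient (fun i => inner ℝ v (whiten (secondMoment P) (clip (z i))) ^ 2) m α) :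
    OpNormResilient (fun i => clip (z i)) m α := by
  refine opNormResilient_of_forall_sumResilient fun u => ?_
  have hiso := integral_inner_cfcMulVec_sqrt_whiten_sq hP u
  have hinner (i : Fin n) : inner ℝ u (clip (z i)) =
      inner ℝ (cfcMulVec Real.sqrt (secondMoment P) u)
        (whiten (secondMoment P) (clip (z i))) := by
    rw [← inner_cfcMulVec, hclip.cfcMulVec_sqrt_whiten (hz i)]
  simp only [hinner]
  refine sumResilient_inner_sq_of_forall_norm_eq_one (fun c v => ?_) h
    (hclip.two_thirds_mul_sq_norm_le hP hmom hk hM hrare hiso)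
    ((hclip.integral_inner_whiten_sq_le hP _).trans_eq (by rw [hiso, one_mul]))
  simp only [real_inner_smul_left, mul_pow, integral_const_mul]

lemma IsClipping.measureReal_exists_not_sumResilient_le [NeZero d]
    (hclip : IsClipping (secondMoment P) b clip) (hmom : MomentBound P k M) (hk : 4 ≤ k)
    (hM : 0 ≤ M) (hb : 0 < b) (hδ : 0 < δ) (hδ' : δ ≤ 1 / 4)
    (hn : 400 * (b ^ 2 * Real.log (2 * d / δ)) ≤ n) (hZm : ∀ i, Measurable (Z i))
    (hZP : ∀ i, μ.map (Z i) = P) (hind : iIndepFun Z μ) :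
    μ.real {ω | ∃ v : E d, ‖v‖ = 1 ∧
      2 / 3 ≤ ∫ x, inner ℝ v (whiten (secondMoment P) (clip x)) ^ 2 ∂P ∧
      ∫ x, inner ℝ v (whiten (secondMoment P) (clip x)) ^ 2 ∂P ≤ 1 ∧
      ¬ SumResilient (fun i => inner ℝ v (whiten (secondMoment P) (clip (Z i ω))) ^ 2) m
        (124 * rate d n m k M b δ)} ≤ 3 * δ := by
  have hmeas := hclip.measurable_whiten
  have htransfer (i : Fin n) {f : E d → ℝ} (hf : Measurable f) :
      ∫ ω, f (Z i ω) ∂μ = ∫ x, f x ∂P := by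
    rw [← hZP i, integral_map (hZm i).aemeasurable hf.aestronglyMeasurable]
  refine HeavyTail.measureReal_exists_not_sumResilient_le (fun i => hmeas.comp (hZm i))
    (fun i => .of_forall fun ω => hclip.norm_whiten_le (Z i ω))
    (hind.comp (fun _ x => whiten (secondMoment P) (clip x)) fun _ => hmeas)
    (fun i v => htransfer i ((hclip.measurable_inner_whiten v).pow_const 2)) hk hM hb
    (fun i w => ?_) hδ hδ' hn
  exact (htransfer i ((hclip.measurable_inner_whiten w).abs.pow_const k)).trans_le
    (hclip.integral_abs_inner_whiten_rpow_le hmom (by linarith) hM w)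

lemma IsClipping.measureReal_not_opNormResilient_le [NeZero d]
    [IsProbabilityMeasure P] (hclip : IsClipping (secondMoment P) b clip)
    (hP : MemLp (fun z : E d => z) 2 P) (hmom : MomentBound P k M) (hk : 4 ≤ k)
    (hM : 0 ≤ M) (hb : 0 < b) (hδ : 0 < δ) (hδ' : δ ≤ 1 / 4)
    (hrare : 3 * M ^ 2 * P.real {z | b < mnorm (secondMoment P) z} ^ (1 - 2 / k) ≤ 1)
    (hn : 400 * (b ^ 2 * Real.log (2 * d / δ)) ≤ n) (hZm : ∀ i, Measurable (Z i))
    (hZP : ∀ i, μ.map (Z i) = P) (hind : iIndepFun Z μ) :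
    μ.real {ω | ¬ OpNormResilient (fun i => clip (Z i ω)) m (124 * rate d n m k M b δ)}
      ≤ 3 * δ := by
  have hrange : ∀ᵐ ω ∂μ, ∀ i,
      cfcMulVec Real.sqrt (secondMoment P) (whiten (secondMoment P) (Z i ω)) = Z i ω :=
    ae_all_iff.2 fun i => (MeasurePreserving.mk (hZm i) (hZP i)).quasiMeasurePreserving.ae
      (ae_cfcMulVec_sqrt_whiten hP)
  refine (ENNReal.toReal_mono (measure_ne_top μ _) (measure_mono_ae ?_)).trans
    (hclip.measureReal_exists_not_sumResilient_le (m := m) hmom hk hM hb hδ hδ' hn hZm hZP hind)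
  filter_upwards [hrange] with ω hω hnot
  by_contra hbad
  refine hnot (hclip.opNormResilient_of_forall_norm_eq_one hP hmom (by linarith) hM hrare hω
    fun v hv hv₁ hv₂ => ?_)
  by_contra hv₃
  exact hbad ⟨v, hv, hv₁, hv₂, hv₃⟩

end Sample

end HeavyTail

theorem mainTheorem2 :
    ∃ C₀ C : ℝ, 0 < C₀ ∧ 0 < C ∧
      ∀ (d : ℕ), 1 ≤ d →
      ∀ (k M b δ : ℝ), 4 ≤ k → 0 ≤ M → 0 < b → 0 < δ → δ < 1 →
      ∀ (P : Measure (HeavyTail.E d)), IsProbabilityMeasure P →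
        MemLp (fun z : HeavyTail.E d => z) 2 P →
        HeavyTail.MomentBound P k M →
        3 * M ^ 2 *
          P.real {z | b < HeavyTail.mnorm (HeavyTail.secondMoment P) z} ^ (1 - 2 / k) ≤ 1 →
      ∀ (clip : HeavyTail.E d → HeavyTail.E d),
        HeavyTail.IsClipping (HeavyTail.secondMoment P) b clip →
      ∀ (n m : ℕ), C₀ * (b ^ 2 * Real.log (2 * d / δ)) ≤ n → m ≤ n →
      ∀ (Ω : Type*) (_ : MeasurableSpace Ω) (μ : Measure Ω), IsProbabilityMeasure μ →
      ∀ (Z : Fin n → Ω → HeavyTail.E d),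
        (∀ i, Measurable (Z i)) → (∀ i, μ.map (Z i) = P) → iIndepFun Z μ →
        1 - 4 * δ ≤ μ.real {ω | HeavyTail.OpNormResilient (fun i => clip (Z i ω)) m
          (C * HeavyTail.rate d n m k M b δ)} := by
  refine ⟨400, 124, by norm_num, by norm_num, ?_⟩
  intro d hd k M b δ hk hM hb hδ _ P _ hP hmom hrare clip hclip n m hn _ Ω _ μ _ Z hZm hZP hind
  have : NeZero d := ⟨by omega⟩
  rcases le_total (1 / 4) δ with hδ' | hδ'
  · exact le_trans (by linarith) measureReal_nonneg
  have hbad := hclip.measureReal_not_opNormResilient_le (m := m) hP hmom hk hM hb hδ hδ' hrare hn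
    hZm hZP hind
  set s := {ω | HeavyTail.OpNormResilient (fun i => clip (Z i ω)) m
    (124 * HeavyTail.rate d n m k M b δ)}
  have hcover : 1 ≤ μ.real s + μ.real sᶜ := by
    simpa [Set.union_compl_self] using measureReal_union_le (μ := μ) s sᶜ
  change μ.real sᶜ ≤ 3 * δ at hbad
  linarith
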